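/- **Setting.** Let $d\in\{1,2\}$, let $\Omega\subset\mathbb R^d$ be a bounded domain, $T>0$, $0<\alpha<1$, $\sigma=\alpha/2$. Write $(\cdot,\cdot)$ and $\|\cdot\|$ for the inner product and norm of $L^2(\Omega)$, and $l(w)=\int_\Omega w\,dx$. Let $a:\mathbb R\to\mathbb R$ be Lipschitz continuous with $0<m_1\le a(s)\le m_2<\infty$ for all $s$, and let $f\in L^2(0,T;L^2(\Omega))$ be given as a function with point values $f(t)\in L^2(\Omega)$. Let $V_h\subset H^1_0(\Omega)$ be the space of continuous functions that are affine on every element of a conforming triangulation (into intervals if $d=1$, triangles if $d=2$) whose union is contained in $\overline\Omega$, and that vanish on $\partial\Omega$ and outside this union. For $N\ge1$ and $r\ge1$ put $t_n=T(n/N)^r$ $(0\le n\le N)$, and, for $1\le n\le N$, $\tau_n=t_n-t_{n-1}$, $t_{n-\sigma}=(1-\sigma)t_n+\sigma t_{n-1}$, $t_{n-1/2}=\frac12(t_n+t_{n-1})$, $U^{n,\sigma}=(1-\sigma)U^n+\sigma U^{n-1}$, and $$D_N^\alpha U^{n-\sigma}=\sum_{j=1}^n g_{n,j}\,(U^j-U^{j-1}),$$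 where $g_{1,1}=\tau_1^{-1}a_{1,1}$ and, for $n\ge2$, $g_{n,1}=\tau_1^{-1}(a_{n,1}-b_{n,1})$, $g_{n,j}=\tau_j^{-1}(a_{n,j}+b_{n,j-1}-b_{n,j})$ for $2\le j\le n-1$, and $g_{n,n}=\tau_n^{-1}(a_{n,n}+b_{n,n-1})$, with $$a_{n,n}=\frac1{\Gamma(1-\alpha)}\int_{t_{n-1}}^{t_{n-\sigma}}(t_{n-\sigma}-\eta)^{-\alpha}d\eta,\qquad a_{n,j}=\frac1{\Gamma(1-\alpha)}\int_{t_{j-1}}^{t_j}(t_{n-\sigma}-\eta)^{-\alpha}d\eta\quad(1\le j\le n-1),$$ $$b_{n,j}=\frac{2}{\Gamma(1-\alpha)(t_{j+1}-t_{j-1})}\int_{t_{j-1}}^{t_j}(t_{n-\sigma}-\eta)^{-\alpha}(\eta-t_{j-1/2})\,d\eta\quad(1\le j\le n-1).$$ Let $U^0\in V_h$ be arbitrary and let $U^1,\dots,U^N\in V_h$ be any solution of the fully-discrete scheme $$\bigl(D_N^\alpha U^{n-\sigma},v\bigr)+a\bigl(l(U^{n,\sigma})\bigr)\,(\nabla U^{n,\sigma},\nabla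 v)=\bigl(f(t_{n-\sigma}),v\bigr)\qquad\text{for all }v\in V_h,\ 1\le n\le N.$$ Let $E_\alpha(z)=\sum_{k\ge0}z^k/\Gamma(\alpha k+1)$ be the Mittag-Leffler function and $F_n=\max_{1\le j\le n}\|f(t_{j-\sigma})\|$. **Theorem.** For every $n=1,\dots,N$, $$\|U^n\|\le C_n\,(1+\|U^0\|),\qquad \|\nabla U^n\|\le C_n'\,(1+\|\nabla U^0\|),$$ where $$C_n=2E_\alpha\bigl(\tfrac{11}{4}t_n^\alpha\bigr)\max\Bigl\{1,\Bigl(\tfrac{11T^\alpha}{4\Gamma(1+\alpha)}+1\Bigr)F_n\Bigr\},\qquad C_n'=2E_\alpha\bigl(\tfrac{11}{2}t_n^\alpha\bigr)\max\Bigl\{1,\tfrac1{\sqrt{m_1}}\Bigl(\tfrac{11T^\alpha}{4\Gamma(1+\alpha)}+1\Bigr)F_n\Bigr\}.$$ These constants are $\alpha$-robust and independent of the discretisation: for all $\alpha_0>0$ and $F\in\mathbb R$ there is a constant $C>0$, depending only on $T,m_1,\alpha_0,F$ (in particular not on $n$, $N$, $r$, the triangulation, or $\alpha\in[\alpha_0,1)$),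 such that whenever $\alpha\in[\alpha_0,1)$ and $F_n\le F$ one has $C_n\le C$ and $C_n'\le C$, hence $\|U^n\|\le C(1+\|U^0\|)$ and $\|\nabla U^n\|\le C(1+\|\nabla U^0\|)$. -/

import Mathlib

open MeasureTheory

noncomputable section

namespace FracNonlocal

/-! ### The temporal discretisation -/

/-- The graded mesh point `t_n = T (n/N)^r`. -/
def meshPt (T r : ℝ) (N n : ℕ) : ℝ := T * ((n : ℝ) / (N : ℝ)) ^ r

/-- The time step `τ_n = t_n - t_{n-1}` (used for `n ≥ 1`). -/
def timeStep (T r : ℝ) (N n : ℕ) : ℝ := meshPt T r N n - meshPt T r N (n - 1)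

/-- The point `t_{n-σ} = (1-σ) t_n + σ t_{n-1}` with `σ = α/2` (used for `n ≥ 1`). -/
def offsetPt (α T r : ℝ) (N n : ℕ) : ℝ :=
  (1 - α / 2) * meshPt T r N n + α / 2 * meshPt T r N (n - 1)

/-- The coefficients `a_{n,j}`, `1 ≤ j ≤ n`; the interval of integration is
`[t_{n-1}, t_{n-σ}]` if `j = n` and `[t_{j-1}, t_j]` if `j < n`. -/
def aCoeff (α T r : ℝ) (N n j : ℕ) : ℝ :=
  1 / Real.Gamma (1 - α) *
    ∫ η in (meshPt T r N (j - 1))..(if j = n then offsetPt α T r N n else meshPt T r N j),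
      (offsetPt α T r N n - η) ^ (-α)

/-- The coefficients `b_{n,j}`, `1 ≤ j ≤ n - 1`, where `t_{j-1/2} = (t_{j-1} + t_j)/2`. -/
def bCoeff (α T r : ℝ) (N n j : ℕ) : ℝ :=
  2 / (Real.Gamma (1 - α) * (meshPt T r N (j + 1) - meshPt T r N (j - 1))) *
    ∫ η in (meshPt T r N (j - 1))..(meshPt T r N j),
      (offsetPt α T r N n - η) ^ (-α) * (η - (meshPt T r N (j - 1) + meshPt T r N j) / 2)

/-- The weights `g_{n,j}`, `1 ≤ j ≤ n`, of the `L2-1_σ` formula. -/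
def gCoeff (α T r : ℝ) (N n j : ℕ) : ℝ :=
  if n = 1 then (timeStep T r N j)⁻¹ * aCoeff α T r N n j
  else if j = 1 then
    (timeStep T r N j)⁻¹ * (aCoeff α T r N n j - bCoeff α T r N n j)
  else if j = n then
    (timeStep T r N j)⁻¹ * (aCoeff α T r N n j + bCoeff α T r N n (j - 1))
  else
    (timeStep T r N j)⁻¹ *
      (aCoeff α T r N n j + bCoeff α T r N n (j - 1) - bCoeff α T r N n j)

/-- The `L2-1_σ` approximation `D^α_N U^{n-σ} = ∑_{j=1}^n g_{n,j} (U^j - U^{j-1})` of the Caputo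
derivative of order `α` at `t_{n-σ}`. -/
def discreteCaputo {V : Type*} [AddCommGroup V] [Module ℝ V]
    (α T r : ℝ) (N : ℕ) (U : ℕ → V) (n : ℕ) : V :=
  ∑ j ∈ Finset.Icc 1 n, gCoeff α T r N n j • (U j - U (j - 1))

/-- The weighted value `U^{n,σ} = (1-σ) U^n + σ U^{n-1}` with `σ = α/2` (used for `n ≥ 1`). -/
def weightedValue {V : Type*} [AddCommGroup V] [Module ℝ V]
    (α : ℝ) (U : ℕ → V) (n : ℕ) : V :=
  (1 - α / 2) • U n + (α / 2) • U (n - 1)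

/-! ### The spatial discretisation -/

/-- A conforming triangulation (into intervals if `d = 1`, triangles if `d = 2`) inscribed in `Ω`:
finitely many nondegenerate closed `d`-simplices, any two of which meet in a common face or not at
all, and whose union is contained in the closure of `Ω`. It may be all of the closure of `Ω`, or,
for curved boundaries, an inscribed polygon. -/
structure IsTriangulation {d : ℕ}
    (K : Geometry.SimplicialComplex ℝ (EuclideanSpace ℝ (Fin d)))
    (Ω : Set (EuclideanSpace ℝ (Fin d))) : Prop where
  finite : K.faces.Finite
  pure : ∀ s ∈ K.faces, ∃ t ∈ K.faces, s ⊆ t ∧ t.card = d + 1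
  subset : K.space ⊆ closure Ω

/-- The finite element space `V_h`: the continuous functions that are affine on each simplex of the
triangulation and that vanish on the boundary of `Ω` and outside the triangulated region (functions
are extended by zero to the whole space). -/
def feSpace {d : ℕ} (Ω : Set (EuclideanSpace ℝ (Fin d)))
    (K : Geometry.SimplicialComplex ℝ (EuclideanSpace ℝ (Fin d))) :
    Submodule ℝ (EuclideanSpace ℝ (Fin d) → ℝ) where
  carrier := {v | Continuous v ∧ (∀ x, x ∉ Ω → v x = 0) ∧ (∀ x, x ∉ K.space → v x = 0) ∧
    ∀ s ∈ K.faces, s.card = d + 1 → ∃ A : EuclideanSpace ℝ (Fin d) →ᵃ[ℝ] ℝ,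
      ∀ x ∈ convexHull ℝ (s : Set (EuclideanSpace ℝ (Fin d))), v x = A x}
  zero_mem' := ⟨continuous_const, fun _ _ => rfl, fun _ _ => rfl, fun _ _ _ => ⟨0, fun _ _ => rfl⟩⟩
  add_mem' := by
    rintro u v ⟨hu1, hu2, hu3, hu4⟩ ⟨hv1, hv2, hv3, hv4⟩
    refine ⟨hu1.add hv1, fun x hx => by simp [hu2 x hx, hv2 x hx],
      fun x hx => by simp [hu3 x hx, hv3 x hx], fun s hs hc => ?_⟩
    obtain ⟨A, hA⟩ := hu4 s hs hc
    obtain ⟨B, hB⟩ := hv4 s hs hc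
    exact ⟨A + B, fun x hx => by simp [hA x hx, hB x hx]⟩
  smul_mem' := by
    rintro c v ⟨hv1, hv2, hv3, hv4⟩
    refine ⟨hv1.const_smul c, fun x hx => by simp [hv2 x hx],
      fun x hx => by simp [hv3 x hx], fun s hs hc => ?_⟩
    obtain ⟨A, hA⟩ := hv4 s hs hc
    exact ⟨c • A, fun x hx => by simp [hA x hx]⟩

/-- The `L²(Ω)` inner product `(u, v)`. -/
def l2Inner {d : ℕ} (Ω : Set (EuclideanSpace ℝ (Fin d)))
    (u v : EuclideanSpace ℝ (Fin d) → ℝ) : ℝ :=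
  ∫ x in Ω, u x * v x

/-- The Dirichlet form `(∇u, ∇v)`. For continuous piecewise affine functions the classical gradient,
which exists off the faces of the simplices, is the weak gradient. -/
def gradInner {d : ℕ} (Ω : Set (EuclideanSpace ℝ (Fin d)))
    (u v : EuclideanSpace ℝ (Fin d) → ℝ) : ℝ :=
  ∫ x in Ω, inner ℝ (gradient u x) (gradient v x)

/-- The norm `‖u‖` of `L²(Ω)`. -/
def l2Norm {d : ℕ} (Ω : Set (EuclideanSpace ℝ (Fin d)))
    (u : EuclideanSpace ℝ (Fin d) → ℝ) : ℝ :=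
  Real.sqrt (l2Inner Ω u u)

/-- The norm `‖∇u‖` of the gradient in `L²(Ω)`. -/
def gradNorm {d : ℕ} (Ω : Set (EuclideanSpace ℝ (Fin d)))
    (u : EuclideanSpace ℝ (Fin d) → ℝ) : ℝ :=
  Real.sqrt (gradInner Ω u u)

/-! ### The fully-discrete scheme -/

/-- `U^0, …, U^N` solves the fully-discrete scheme: for all `1 ≤ n ≤ N` and all `v ∈ V_h`,
`(D^α_N U^{n-σ}, v) + a(l(U^{n,σ})) (∇U^{n,σ}, ∇v) = (f(t_{n-σ}), v)`, where `l(w) = ∫_Ω w`.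
The initial value `U^0 ∈ V_h` is arbitrary. -/
def IsFullyDiscreteSolution {d : ℕ} (Ω : Set (EuclideanSpace ℝ (Fin d)))
    (K : Geometry.SimplicialComplex ℝ (EuclideanSpace ℝ (Fin d)))
    (a : ℝ → ℝ) (f : ℝ → Lp ℝ 2 (volume.restrict Ω))
    (α T r : ℝ) (N : ℕ) (U : ℕ → feSpace Ω K) : Prop :=
  ∀ n ∈ Finset.Icc 1 N, ∀ v : feSpace Ω K,
    l2Inner Ω (discreteCaputo α T r N U n : feSpace Ω K) v
      + a (∫ x in Ω, (weightedValue α U n : feSpace Ω K).1 x)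
        * gradInner Ω (weightedValue α U n : feSpace Ω K) v
    = l2Inner Ω (f (offsetPt α T r N n)) v

/-! ### The constants -/

/-- The Mittag-Leffler function `E_α(z) = ∑_k z^k / Γ(αk + 1)`. -/
def mittagLeffler (α z : ℝ) : ℝ := ∑' k : ℕ, z ^ k / Real.Gamma (α * k + 1)

/-- `max_{1 ≤ j ≤ n} ‖f(t_{j-σ})‖`. -/
def maxSource {d : ℕ} {Ω : Set (EuclideanSpace ℝ (Fin d))}
    (f : ℝ → Lp ℝ 2 (volume.restrict Ω)) (α T r : ℝ) (N n : ℕ) : ℝ :=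
  ((Finset.Icc 1 n).sup fun j => ‖f (offsetPt α T r N j)‖₊ : NNReal)

/-- The constant of the `L²` bound, `t` standing for `t_n` and `F` for the maximum of the norms of
the source samples. -/
def l2Const (α T t F : ℝ) : ℝ :=
  2 * mittagLeffler α (11 / 4 * t ^ α) *
    max 1 ((11 * T ^ α / (4 * Real.Gamma (1 + α)) + 1) * F)

/-- The constant of the gradient bound. -/
def gradConst (m₁ α T t F : ℝ) : ℝ :=
  2 * mittagLeffler α (11 / 2 * t ^ α) *
    max 1 (1 / Real.sqrt m₁ * (11 * T ^ α / (4 * Real.Gamma (1 + α)) + 1) * F)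

end FracNonlocal

end

open Set intervalIntegral

namespace FracNonlocal

/-! ### Integrals of monotone and convex functions over an interval -/

/-! The proof is a discrete energy argument followed by comparison with an explicit barrier; no
Gronwall inequality is needed.

The weights are controlled by sandwiching. Write k_j for the Caputo kernel at t_{n-σ} evaluated at
the node t_j (`nodeKernel`). The kernel is increasing and convex and the steps of the mesh increase,
so k_{j-1} ≤ g_{n,j} ≤ k_j for j < n (`nodeKernel_le_gCoeff`, `gCoeff_le_nodeKernel`). The weights
are therefore positive and nondecreasing in j. The exact value of a_{n,n} gives in addition (1-σ)
g_{n,n-1} ≤ (1-α) g_{n,n} (`gCoeff_last`).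

These facts have two consequences by Abel summation. For every positive semidefinite form, D(‖U‖²) ≤
2 (DU, U^{n,σ}) (`energy_le`). Moreover, D satisfies a comparison principle
(`nonpos_of_discreteCaputo_nonpos`). The barrier is 2 t^α / Γ(1+α), whose discrete derivative is at
least 1 (`one_le_discreteCaputo_rpow`): cell by cell, Chebyshev's integral inequality compares the
difference quotient of t^α with the Beta integral giving its exact Caputo derivative.

Testing the scheme with U^{n,σ}, where the diffusion term is nonnegative, bounds the L² norm.
Testing with D U^{n-σ} and absorbing the source into ‖D U^{n-σ}‖² bounds the gradient. The results,
‖U^n‖ ≤ ‖U^0‖ + 4 F_n t_n^α / Γ(1+α) and ‖∇U^n‖² ≤ ‖∇U^0‖² + (F_n² / m₁) t_n^α / Γ(1+α), are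
stronger than the stated ones: of the Mittag-Leffler factor only E_α ≥ 1 is used. Robustness in α
follows from an elementary lower bound for Γ (`rpow_mul_exp_le_Gamma`). -/

lemma chebyshev_integral_mul_le {p q : ℝ → ℝ} {a b : ℝ} (hab : a ≤ b)
    (hp : MonotoneOn p (Ioo a b)) (hq : AntitoneOn q (Ioo a b))
    (ip : IntervalIntegrable p volume a b) (iq : IntervalIntegrable q volume a b)
    (ipq : IntervalIntegrable (fun x => p x * q x) volume a b) :
    (b - a) * ∫ x in a..b, p x * q x ≤ (∫ x in a..b, p x) * ∫ x in a..b, q x := by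
  -- Integrate (p x - p y) (q x - q y) ≤ 0 over x here, and over y below. The open interval matters:
  -- the kernels used later are singular at an endpoint, where the default value of `rpow` breaks
  -- monotonicity.
  have key : ∀ y ∈ Ioo a b,
      (∫ x in a..b, p x * q x) + (b - a) * (p y * q y)
        ≤ p y * (∫ x in a..b, q x) + q y * ∫ x in a..b, p x := by
    intro y hy
    have h : ∫ x in a..b, (p x * q x + p y * q y) ≤ ∫ x in a..b, (p y * q x + q y * p x) := by
      refine integral_mono_on_of_le_Ioo hab (ipq.add intervalIntegrable_const)
        ((iq.const_mul _).add (ip.const_mul _)) fun x hx => ?_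
      rcases le_total x y with hxy | hxy
      · nlinarith [mul_nonneg (sub_nonneg.2 (hp hx hy hxy)) (sub_nonneg.2 (hq hx hy hxy))]
      · nlinarith [mul_nonneg (sub_nonneg.2 (hp hy hx hxy)) (sub_nonneg.2 (hq hy hx hxy))]
    rw [integral_add ipq intervalIntegrable_const,
      integral_add (iq.const_mul _) (ip.const_mul _)] at h
    simp only [intervalIntegral.integral_const, intervalIntegral.integral_const_mul,
      smul_eq_mul] at h
    linarith
  have h := integral_mono_on_of_le_Ioo hab
    ((intervalIntegrable_const (c := ∫ x in a..b, p x * q x)).add (ipq.const_mul (b - a)))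
    ((ip.mul_const (∫ x in a..b, q x)).add (iq.mul_const (∫ x in a..b, p x))) key
  rw [integral_add intervalIntegrable_const (ipq.const_mul _),
    integral_add (ip.mul_const _) (iq.mul_const _)] at h
  simp only [intervalIntegral.integral_const, intervalIntegral.integral_const_mul,
    intervalIntegral.integral_mul_const, smul_eq_mul] at h
  linarith

/-! ### First moments about the midpoint, and secant bounds for convex functions -/

section Moment

variable {k : ℝ → ℝ} {a b : ℝ}

lemma integral_sub_midpoint (a b : ℝ) : ∫ x in a..b, (x - (a + b) / 2) = 0 := by
  rw [integral_sub intervalIntegrable_id intervalIntegrable_const]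
  simp [integral_id]
  ring

/-- The midpoint weight has mean zero, so c is free. Choosing the midpoint, left or right value of k
yields the three estimates that follow. -/
lemma moment_eq (c : ℝ) (hk : ContinuousOn k (Icc a b)) (hab : a ≤ b) :
    ∫ x in a..b, k x * (x - (a + b) / 2) = ∫ x in a..b, (k x - c) * (x - (a + b) / 2) := by
  have i : IntervalIntegrable (fun x => k x * (x - (a + b) / 2)) volume a b := by
    apply ContinuousOn.intervalIntegrable
    rw [uIcc_of_le hab]
    fun_prop
  have i' : IntervalIntegrable (fun x => c * (x - (a + b) / 2)) volume a b := by
    apply Continuous.intervalIntegrable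
    fun_prop
  simp_rw [sub_mul (k _) c]
  rw [integral_sub i i', intervalIntegral.integral_const_mul, integral_sub_midpoint, mul_zero,
    sub_zero]

lemma moment_nonneg (hk : ContinuousOn k (Icc a b)) (hm : MonotoneOn k (Icc a b)) (hab : a ≤ b) :
    0 ≤ ∫ x in a..b, k x * (x - (a + b) / 2) := by
  rw [moment_eq (k ((a + b) / 2)) hk hab]
  refine integral_nonneg hab fun x hx => ?_
  have hmid : (a + b) / 2 ∈ Icc a b := ⟨by linarith, by linarith⟩
  rcases le_total x ((a + b) / 2) with h | h
  · exact mul_nonneg_of_nonpos_of_nonpos (sub_nonpos.2 (hm hx hmid h)) (sub_nonpos.2 h)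
  · exact mul_nonneg (sub_nonneg.2 (hm hmid hx h)) (sub_nonneg.2 h)

lemma moment_le_left (hk : ContinuousOn k (Icc a b)) (hm : MonotoneOn k (Icc a b)) (hab : a ≤ b) :
    ∫ x in a..b, k x * (x - (a + b) / 2) ≤
      (b - a) / 2 * ((∫ x in a..b, k x) - (b - a) * k a) := by
  have i : IntervalIntegrable k volume a b := by
    apply ContinuousOn.intervalIntegrable; rwa [uIcc_of_le hab]
  have e : (b - a) / 2 * ((∫ x in a..b, k x) - (b - a) * k a) =
      ∫ x in a..b, (b - a) / 2 * (k x - k a) := by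
    rw [intervalIntegral.integral_const_mul, integral_sub i intervalIntegrable_const]
    simp
  rw [moment_eq (k a) hk hab, e]
  refine integral_mono_on hab ?_ ((i.sub intervalIntegrable_const).const_mul _) fun x hx => ?_
  · apply ContinuousOn.intervalIntegrable
    rw [uIcc_of_le hab]
    fun_prop
  · have := hm (left_mem_Icc.2 hab) hx hx.1
    nlinarith [mul_nonneg (sub_nonneg.2 this) (sub_nonneg.2 hx.2)]

lemma moment_le_right (hk : ContinuousOn k (Icc a b)) (hm : MonotoneOn k (Icc a b))
    (hab : a ≤ b) :
    ∫ x in a..b, k x * (x - (a + b) / 2) ≤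
      (b - a) / 2 * ((b - a) * k b - ∫ x in a..b, k x) := by
  have i : IntervalIntegrable k volume a b := by
    apply ContinuousOn.intervalIntegrable; rwa [uIcc_of_le hab]
  have e : (b - a) / 2 * ((b - a) * k b - ∫ x in a..b, k x) =
      ∫ x in a..b, (b - a) / 2 * (k b - k x) := by
    rw [intervalIntegral.integral_const_mul, integral_sub intervalIntegrable_const i]
    simp
  rw [moment_eq (k b) hk hab, e]
  refine integral_mono_on hab ?_ ((intervalIntegrable_const.sub i).const_mul _) fun x hx => ?_
  · apply ContinuousOn.intervalIntegrable
    rw [uIcc_of_le hab]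
    fun_prop
  · have := hm hx (right_mem_Icc.2 hab) hx.2
    nlinarith [mul_nonneg (sub_nonneg.2 this) (sub_nonneg.2 hx.1)]

lemma integral_affine (a b c m x₀ : ℝ) :
    ∫ x in a..b, (c + m * (x - x₀)) = (b - a) * (c + m * ((a + b) / 2 - x₀)) := by
  rw [integral_add intervalIntegrable_const
    ((intervalIntegrable_id.sub intervalIntegrable_const).const_mul _),
    intervalIntegral.integral_const_mul,
    integral_sub intervalIntegrable_id intervalIntegrable_const]
  simp [integral_id]
  ring

lemma integral_le_trapezoid (hk : ContinuousOn k (Icc a b)) (hc : ConvexOn ℝ (Icc a b) k)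
    (hab : a < b) : ∫ x in a..b, k x ≤ (b - a) * ((k a + k b) / 2) := by
  have i : IntervalIntegrable k volume a b := by
    apply ContinuousOn.intervalIntegrable; rwa [uIcc_of_le hab.le]
  have hpos : 0 < b - a := sub_pos.2 hab
  calc ∫ x in a..b, k x ≤ ∫ x in a..b, (k a + (k b - k a) / (b - a) * (x - a)) := by
        refine integral_mono_on hab.le i ?_ fun x hx => ?_
        · apply Continuous.intervalIntegrable; fun_prop
        · have h := hc.2 (left_mem_Icc.2 hab.le) (right_mem_Icc.2 hab.le)
            (div_nonneg (sub_nonneg.2 hx.2) hpos.le) (div_nonneg (sub_nonneg.2 hx.1) hpos.le)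
            (by field_simp; ring)
          simp only [smul_eq_mul] at h
          have e1 : (b - x) / (b - a) * a + (x - a) / (b - a) * b = x := by field_simp; ring
          rw [e1] at h
          refine h.trans_eq ?_
          field_simp
          ring
    _ = _ := by
        rw [integral_affine]
        field_simp
        ring

/-- By convexity, k lies on [a, b] above the secant through b and c extended to the left. This
trades a defect on one mesh cell for an increment over the next. -/
lemma right_sub_integral_le {c : ℝ} (hk : ContinuousOn k (Icc a b)) (hc : ConvexOn ℝ (Icc a c) k)
    (hab : a ≤ b) (hbc : b < c) :
    (b - a) * k b - ∫ x in a..b, k x ≤ (b - a) ^ 2 / 2 * ((k c - k b) / (c - b)) := by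
  have i : IntervalIntegrable k volume a b := by
    apply ContinuousOn.intervalIntegrable; rwa [uIcc_of_le hab]
  have : ∫ x in a..b, (k b + (k c - k b) / (c - b) * (x - b)) ≤ ∫ x in a..b, k x := by
    refine integral_mono_on hab ?_ i fun x hx => ?_
    · apply Continuous.intervalIntegrable; fun_prop
    · rcases hx.2.eq_or_lt with rfl | hxb
      · simp
      · have h := hc.slope_mono_adjacent ⟨hx.1, hx.2.trans hbc.le⟩
          (right_mem_Icc.2 (hab.trans hbc.le)) hxb hbc
        rw [div_le_iff₀ (sub_pos.2 hxb)] at h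
        nlinarith
  rw [integral_affine] at this
  nlinarith

end Moment

/-! ### The weakly singular kernel -/

section Kernel

variable {α c : ℝ}

lemma kernel_monotoneOn (hα : 0 ≤ α) (c : ℝ) : MonotoneOn (fun x => (c - x) ^ (-α)) (Iio c) := by
  intro x hx y hy hxy
  exact Real.rpow_le_rpow_of_nonpos (sub_pos.2 hy) (by linarith) (by linarith)

lemma kernel_continuousOn (α c : ℝ) : ContinuousOn (fun x => (c - x) ^ (-α)) (Iio c) := by
  refine ContinuousOn.rpow_const (by fun_prop) fun x hx => Or.inl (sub_pos.2 hx).ne'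

lemma kernel_convexOn (hα : 0 ≤ α) (c : ℝ) : ConvexOn ℝ (Iio c) (fun x => (c - x) ^ (-α)) := by
  have hd : ∀ x ∈ Iio c, HasDerivAt (fun x => (c - x) ^ (-α)) (α * (c - x) ^ (-(α + 1))) x := by
    intro x hx
    refine (((hasDerivAt_id x).const_sub c).rpow_const (p := -α)
      (Or.inl (sub_pos.2 hx).ne')).congr_deriv ?_
    rw [show -α - 1 = -(α + 1) by ring]
    simp
  refine MonotoneOn.convexOn_of_deriv (convex_Iio c) (kernel_continuousOn α c) ?_ ?_
  · rw [interior_Iio]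
    exact fun x hx => (hd x hx).differentiableAt.differentiableWithinAt
  · rw [interior_Iio]
    intro x hx y hy hxy
    rw [(hd x hx).deriv, (hd y hy).deriv]
    exact mul_le_mul_of_nonneg_left
      (kernel_monotoneOn (by linarith : 0 ≤ α + 1) c hx hy hxy) hα

lemma intervalIntegrable_kernel (hα1 : α < 1) (a b : ℝ) (c : ℝ) :
    IntervalIntegrable (fun x => (c - x) ^ (-α)) volume a b := by
  have h := (intervalIntegrable_rpow' (a := c - a) (b := c - b) (r := -α)
    (by linarith)).comp_sub_left c
  simpa using h

lemma integral_kernel_self (hα1 : α < 1) (a d : ℝ) :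
    ∫ x in a..d, (c - x) ^ (-α) = ((c - a) ^ (1 - α) - (c - d) ^ (1 - α)) / (1 - α) := by
  rw [intervalIntegral.integral_comp_sub_left (fun x => x ^ (-α)), integral_rpow (Or.inl (by linarith))]
  ring_nf

/-- The scaled Beta integral at (α, 1 - α): the exponents sum to 1, so the power of t disappears and
Γ(1) = 1. -/
lemma integral_beta_kernel (hα0 : 0 < α) (hα1 : α < 1) {t : ℝ} (ht : 0 < t) :
    ∫ x in (0 : ℝ)..t, (t - x) ^ (-α) * x ^ (α - 1) = Real.Gamma α * Real.Gamma (1 - α) := by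
  have h := Complex.betaIntegral_scaled (α : ℂ) ((1 - α : ℝ) : ℂ) ht
  have h2 := Complex.Gamma_mul_Gamma_eq_betaIntegral (s := (α : ℂ)) (t := ((1 - α : ℝ) : ℂ))
    (by simpa) (by rw [Complex.ofReal_re]; linarith)
  have e : (α : ℂ) + ((1 - α : ℝ) : ℂ) = 1 := by push_cast; ring
  rw [e] at h h2
  rw [Complex.Gamma_one, one_mul, Complex.Gamma_ofReal, Complex.Gamma_ofReal] at h2
  rw [sub_self, Complex.cpow_zero, one_mul, ← h2] at h
  have h3 : ∫ x in (0 : ℝ)..t, (x : ℂ) ^ ((α : ℂ) - 1) * ((t : ℂ) - x) ^ (((1 - α : ℝ) : ℂ) - 1)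
      = ((∫ x in (0 : ℝ)..t, (t - x) ^ (-α) * x ^ (α - 1) : ℝ) : ℂ) := by
    rw [← intervalIntegral.integral_ofReal]
    refine intervalIntegral.integral_congr fun x hx => ?_
    rw [uIcc_of_le ht.le] at hx
    rw [Complex.ofReal_mul, Complex.ofReal_cpow hx.1, Complex.ofReal_cpow (sub_nonneg.2 hx.2),
      mul_comm]
    push_cast
    ring_nf
  rw [h3] at h
  exact_mod_cast h

lemma intervalIntegrable_beta_kernel (hα0 : 0 < α) (hα1 : α < 1) {t : ℝ} (ht : 0 < t) :
    IntervalIntegrable (fun x => (t - x) ^ (-α) * x ^ (α - 1)) volume 0 t := by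
  -- A non-integrable function has integral 0 by convention, but the value just computed is
  -- positive.
  by_contra h
  have h1 := integral_undef h
  rw [integral_beta_kernel hα0 hα1 ht] at h1
  exact (mul_pos (Real.Gamma_pos_of_pos hα0) (Real.Gamma_pos_of_pos (sub_pos.2 hα1))).ne' h1

/-- Chebyshev's inequality for an increasing kernel and the decreasing derivative of x ^ α:
replacing that derivative by its mean over a cell can only increase the integral. -/
lemma integral_beta_kernel_le (hα0 : 0 < α) (hα1 : α < 1) {a b t : ℝ} (ha : 0 ≤ a) (hab : a < b)
    (hbt : b ≤ t) :
    α * ∫ x in a..b, (t - x) ^ (-α) * x ^ (α - 1) ≤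
      (b - a)⁻¹ * (∫ x in a..b, (t - x) ^ (-α)) * (b ^ α - a ^ α) := by
  have hpos := sub_pos.2 hab
  have h := chebyshev_integral_mul_le (p := fun x => (t - x) ^ (-α)) (q := fun x => x ^ (α - 1))
    hab.le ((kernel_monotoneOn hα0.le t).mono fun x hx => lt_of_lt_of_le hx.2 hbt)
    (fun x hx y hy hxy =>
      Real.rpow_le_rpow_of_nonpos (ha.trans_lt hx.1) hxy (by linarith))
    (intervalIntegrable_kernel hα1 a b t) (intervalIntegrable_rpow' (by linarith))
    ((intervalIntegrable_beta_kernel hα0 hα1 (ha.trans_lt (hab.trans_le hbt))).mono_set (by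
      rw [uIcc_of_le hab.le, uIcc_of_le (ha.trans (hab.le.trans hbt))]
      exact Icc_subset_Icc ha hbt))
  rw [integral_rpow (Or.inl (by linarith)), sub_add_cancel, ← mul_div_assoc, le_div_iff₀ hα0] at h
  rw [mul_assoc, ← div_eq_inv_mul, le_div_iff₀ hpos]
  linarith

end Kernel

end FracNonlocal

namespace FracNonlocal

/-! ### The graded mesh -/

section Mesh

variable {α T r : ℝ} {N : ℕ}

lemma meshPt_zero (hr : 1 ≤ r) : meshPt T r N 0 = 0 := by
  simp [meshPt, Real.zero_rpow (by linarith : r ≠ 0)]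

lemma meshPt_self (hN : 1 ≤ N) : meshPt T r N N = T := by
  have : (N : ℝ) ≠ 0 := by positivity
  simp [meshPt, div_self this]

lemma meshPt_strictMono (hT : 0 < T) (hr : 1 ≤ r) (hN : 1 ≤ N) : StrictMono (meshPt T r N) := by
  have hN' : (0 : ℝ) < N := by positivity
  intro i j hij
  refine mul_lt_mul_of_pos_left (Real.rpow_lt_rpow (by positivity) ?_ (by linarith)) hT
  gcongr

lemma meshPt_nonneg (hT : 0 < T) (n : ℕ) : 0 ≤ meshPt T r N n := by
  unfold meshPt
  positivity

/-- Midpoint convexity of x ^ r. Increasing steps are what keep the corrections `bCoeff` small. -/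
lemma meshPt_step_mono (hT : 0 < T) (hr : 1 ≤ r) (n : ℕ) :
    meshPt T r N (n + 1) - meshPt T r N n ≤ meshPt T r N (n + 2) - meshPt T r N (n + 1) := by
  have h := (convexOn_rpow hr).2 (mem_Ici.2 (by positivity : 0 ≤ (n : ℝ) / N))
    (mem_Ici.2 (by positivity : 0 ≤ ((n + 2 : ℕ) : ℝ) / N)) (by norm_num : (0 : ℝ) ≤ 1 / 2)
    (by norm_num : (0 : ℝ) ≤ 1 / 2) (by norm_num)
  simp only [smul_eq_mul] at h
  rw [show (1 / 2 : ℝ) * (n / N) + 1 / 2 * (((n + 2 : ℕ) : ℝ) / N) = ((n + 1 : ℕ) : ℝ) / N by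
    push_cast; ring] at h
  unfold meshPt
  nlinarith

lemma offsetPt_succ (α T r : ℝ) (N m : ℕ) : offsetPt α T r N (m + 1) =
    meshPt T r N m + (1 - α / 2) * (meshPt T r N (m + 1) - meshPt T r N m) := by
  simp only [offsetPt, Nat.add_sub_cancel]
  ring

lemma meshPt_lt_offsetPt (hT : 0 < T) (hr : 1 ≤ r) (hN : 1 ≤ N) (hα1 : α < 1) (m : ℕ) :
    meshPt T r N m < offsetPt α T r N (m + 1) := by
  rw [offsetPt_succ]
  have := sub_pos.2 (meshPt_strictMono hT hr hN m.lt_succ_self)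
  have := mul_pos (by linarith : 0 < 1 - α / 2) this
  linarith

lemma offsetPt_le_meshPt (hT : 0 < T) (hr : 1 ≤ r) (hN : 1 ≤ N) (hα0 : 0 < α) (m : ℕ) :
    offsetPt α T r N (m + 1) ≤ meshPt T r N (m + 1) := by
  rw [offsetPt_succ]
  have := sub_pos.2 (meshPt_strictMono hT hr hN m.lt_succ_self)
  have := mul_pos hα0 this
  linarith

end Mesh

/-! ### The weights of the `L2-1_σ` formula -/

/-- The conditions on the parameters of the temporal discretisation. -/
structure IsAdmissible (α T r : ℝ) (N : ℕ) : Prop where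
  pos : 0 < α
  lt_one : α < 1
  time_pos : 0 < T
  one_le_grading : 1 ≤ r
  one_le_steps : 1 ≤ N

/-- The kernel of the Caputo derivative between the node `t_j` and the point `t_{n-σ}`. -/
noncomputable def nodeKernel (α T r : ℝ) (N n j : ℕ) : ℝ :=
  1 / Real.Gamma (1 - α) * (offsetPt α T r N n - meshPt T r N j) ^ (-α)

section Weights

variable {α T r : ℝ} {N m j : ℕ}

lemma gCoeff_succ (α T r : ℝ) (N : ℕ) (hj : j ≤ m) : gCoeff α T r N (m + 1) (j + 1) =
    (meshPt T r N (j + 1) - meshPt T r N j)⁻¹ * (aCoeff α T r N (m + 1) (j + 1)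
      + (if j = 0 then 0 else bCoeff α T r N (m + 1) j)
      - (if j = m then 0 else bCoeff α T r N (m + 1) (j + 1))) := by
  by_cases hm : m = 0
  · obtain rfl : j = 0 := by omega
    simp [gCoeff, timeStep, hm]
  · by_cases hj : j = 0
    · subst hj
      simp [gCoeff, timeStep, hm, Ne.symm hm]
    · by_cases hjm : j = m <;> simp [gCoeff, timeStep, hm, hj, hjm]

namespace IsAdmissible

lemma mesh_strictMono (h : IsAdmissible α T r N) : StrictMono (meshPt T r N) :=
  meshPt_strictMono h.time_pos h.one_le_grading h.one_le_steps

lemma step_pos (h : IsAdmissible α T r N) (j : ℕ) :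
    0 < meshPt T r N (j + 1) - meshPt T r N j :=
  sub_pos.2 (h.mesh_strictMono j.lt_succ_self)

lemma step_mono (h : IsAdmissible α T r N) (j : ℕ) :
    meshPt T r N (j + 1) - meshPt T r N j ≤ meshPt T r N (j + 2) - meshPt T r N (j + 1) :=
  meshPt_step_mono h.time_pos h.one_le_grading j

lemma gamma_pos (h : IsAdmissible α T r N) : 0 < 1 / Real.Gamma (1 - α) :=
  one_div_pos.2 (Real.Gamma_pos_of_pos (sub_pos.2 h.lt_one))

lemma Icc_subset_Iio (h : IsAdmissible α T r N) (hj : j ≤ m) (i : ℕ) :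
    Icc (meshPt T r N i) (meshPt T r N j) ⊆ Iio (offsetPt α T r N (m + 1)) := fun _ hx =>
  (hx.2.trans (h.mesh_strictMono.monotone hj)).trans_lt
    (meshPt_lt_offsetPt h.time_pos h.one_le_grading h.one_le_steps h.lt_one m)

lemma nodeKernel_pos (h : IsAdmissible α T r N) (hj : j ≤ m) :
    0 < nodeKernel α T r N (m + 1) j :=
  mul_pos h.gamma_pos (Real.rpow_pos_of_pos
    (sub_pos.2 (h.Icc_subset_Iio hj j (right_mem_Icc.2 le_rfl))) _)

lemma nodeKernel_mono (h : IsAdmissible α T r N) (hj : j + 1 ≤ m) :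
    nodeKernel α T r N (m + 1) j ≤ nodeKernel α T r N (m + 1) (j + 1) := by
  refine mul_le_mul_of_nonneg_left (kernel_monotoneOn h.pos.le _
    (h.Icc_subset_Iio (by omega : j ≤ m) j (right_mem_Icc.2 le_rfl))
    (h.Icc_subset_Iio hj j (right_mem_Icc.2 (h.mesh_strictMono.monotone j.le_succ)))
    (h.mesh_strictMono.monotone j.le_succ)) h.gamma_pos.le

lemma aCoeff_of_lt (α T r : ℝ) (N : ℕ) (hj : j < m) : aCoeff α T r N (m + 1) (j + 1) =
    1 / Real.Gamma (1 - α) * ∫ x in (meshPt T r N j)..(meshPt T r N (j + 1)),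
      (offsetPt α T r N (m + 1) - x) ^ (-α) := by
  simp [aCoeff, hj.ne]

lemma aCoeff_self (h : IsAdmissible α T r N) (m : ℕ) :
    (1 - α) * aCoeff α T r N (m + 1) (m + 1) =
      (1 - α / 2) * (meshPt T r N (m + 1) - meshPt T r N m) * nodeKernel α T r N (m + 1) m := by
  have hpos := mul_pos (by linarith [h.lt_one] : 0 < 1 - α / 2) (h.step_pos m)
  have h1 : 1 - α ≠ 0 := by linarith [h.lt_one]
  simp only [aCoeff, if_true, Nat.add_sub_cancel, nodeKernel]
  have e : ∀ x : ℝ, 0 < x → x ^ (1 - α) = x * x ^ (-α) := fun x hx => by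
    rw [show 1 - α = -α + 1 by ring, Real.rpow_add_one hx.ne', mul_comm]
  rw [integral_kernel_self h.lt_one, sub_self, Real.zero_rpow h1, offsetPt_succ, add_sub_cancel_left,
    e _ hpos]
  field_simp
  ring

lemma bCoeff_nonneg (h : IsAdmissible α T r N) (hj : j < m) :
    0 ≤ bCoeff α T r N (m + 1) (j + 1) := by
  have hle := h.mesh_strictMono.monotone j.le_succ
  have hsub := h.Icc_subset_Iio (Nat.succ_le_of_lt hj) j
  refine mul_nonneg (div_nonneg zero_le_two (mul_nonneg
    (Real.Gamma_pos_of_pos (sub_pos.2 h.lt_one)).le (sub_nonneg.2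
    (h.mesh_strictMono.monotone (by omega))))) ?_
  exact moment_nonneg ((kernel_continuousOn α _).mono hsub)
    ((kernel_monotoneOn h.pos.le _).mono hsub) hle

lemma bCoeff_eq (h : IsAdmissible α T r N) (m j : ℕ) : bCoeff α T r N (m + 1) (j + 1) =
    1 / Real.Gamma (1 - α) * (2 / ((meshPt T r N (j + 1) - meshPt T r N j) +
      (meshPt T r N (j + 2) - meshPt T r N (j + 1)))) *
      ∫ x in (meshPt T r N j)..(meshPt T r N (j + 1)), (offsetPt α T r N (m + 1) - x) ^ (-α) *
        (x - (meshPt T r N j + meshPt T r N (j + 1)) / 2) := by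
  have h1 := (Real.Gamma_pos_of_pos (sub_pos.2 h.lt_one)).ne'
  have h2 : meshPt T r N (j + 2) - meshPt T r N j ≠ 0 :=
    (sub_pos.2 (h.mesh_strictMono (by omega))).ne'
  simp only [bCoeff, Nat.add_sub_cancel]
  rw [show meshPt T r N (j + 1) - meshPt T r N j + (meshPt T r N (j + 2) - meshPt T r N (j + 1)) =
    meshPt T r N (j + 2) - meshPt T r N j by ring]
  congr 1
  field_simp

/-- Since the next step is at least the present step τ, the prefactor 2 / (τ + τ') is at most 1 / τ.
-/
lemma bCoeff_le (h : IsAdmissible α T r N) {m j : ℕ} {M : ℝ}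
    (hM : ∫ x in (meshPt T r N j)..(meshPt T r N (j + 1)), (offsetPt α T r N (m + 1) - x) ^ (-α) *
        (x - (meshPt T r N j + meshPt T r N (j + 1)) / 2) ≤
      (meshPt T r N (j + 1) - meshPt T r N j) / 2 * M) (hM0 : 0 ≤ M) :
    bCoeff α T r N (m + 1) (j + 1) ≤ 1 / Real.Gamma (1 - α) * (M / 2) := by
  have h1 := h.step_pos j
  have h2 := h.step_mono j
  rw [h.bCoeff_eq, mul_assoc]
  refine mul_le_mul_of_nonneg_left ?_ h.gamma_pos.le
  rw [div_mul_eq_mul_div, div_le_iff₀ (by linarith)]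
  nlinarith

lemma bCoeff_le_left (h : IsAdmissible α T r N) (hj : j < m) :
    bCoeff α T r N (m + 1) (j + 1) ≤ (aCoeff α T r N (m + 1) (j + 1) -
      (meshPt T r N (j + 1) - meshPt T r N j) * nodeKernel α T r N (m + 1) j) / 2 := by
  have hle := h.mesh_strictMono.monotone j.le_succ
  have hsub := h.Icc_subset_Iio (Nat.succ_le_of_lt hj) j
  have hc := (kernel_continuousOn α _).mono hsub
  have hm := (kernel_monotoneOn h.pos.le _).mono hsub
  refine (h.bCoeff_le (moment_le_left hc hm hle) ?_).trans_eq ?_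
  · have := (moment_nonneg hc hm hle).trans (moment_le_left hc hm hle)
    exact nonneg_of_mul_nonneg_right this (half_pos (h.step_pos j))
  · rw [aCoeff_of_lt α T r N hj, nodeKernel]
    ring

lemma bCoeff_le_right (h : IsAdmissible α T r N) (hj : j + 1 < m) :
    bCoeff α T r N (m + 1) (j + 1) ≤ (meshPt T r N (j + 1) - meshPt T r N j) / 4 *
      (nodeKernel α T r N (m + 1) (j + 2) - nodeKernel α T r N (m + 1) (j + 1)) := by
  have hle := h.mesh_strictMono.monotone j.le_succ
  have hsub := h.Icc_subset_Iio (by omega : j + 1 ≤ m) j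
  have hc := (kernel_continuousOn α _).mono hsub
  have hm := (kernel_monotoneOn h.pos.le _).mono hsub
  have h1 := h.step_pos j
  have h2 := h.step_mono j
  have hw := h.gamma_pos
  have hnn := nonneg_of_mul_nonneg_right
    ((moment_nonneg hc hm hle).trans (moment_le_right hc hm hle)) (half_pos h1)
  have hk := right_sub_integral_le hc ((kernel_convexOn h.pos.le _).subset
    (h.Icc_subset_Iio hj j) (convex_Icc _ _)) hle (h.mesh_strictMono (j + 1).lt_succ_self)
  have hΔ := sub_nonneg.2 (h.nodeKernel_mono hj)
  refine (h.bCoeff_le (moment_le_right hc hm hle) hnn).trans ?_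
  have h3 := mul_le_mul_of_nonneg_left hk (half_pos hw).le
  have h4 : (meshPt T r N (j + 1) - meshPt T r N j) /
      (meshPt T r N (j + 2) - meshPt T r N (j + 1)) ≤ 1 := (div_le_one (by linarith)).2 h2
  -- The secant over the next cell leaves a factor τ / τ', which is at most 1.
  have h5 := mul_le_mul_of_nonneg_left h4 (mul_nonneg h1.le hΔ)
  refine le_trans (le_of_eq (by ring)) (h3.trans (le_trans (le_of_eq ?_)
    ((mul_le_mul_of_nonneg_left h5 (by norm_num : (0 : ℝ) ≤ 1 / 4)).trans_eq (by ring))))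
  simp only [nodeKernel]
  ring

lemma aCoeff_le (h : IsAdmissible α T r N) (hj : j < m) :
    aCoeff α T r N (m + 1) (j + 1) ≤ (meshPt T r N (j + 1) - meshPt T r N j) / 2 *
      (nodeKernel α T r N (m + 1) j + nodeKernel α T r N (m + 1) (j + 1)) := by
  have hsub := h.Icc_subset_Iio (Nat.succ_le_of_lt hj) j
  have hk := integral_le_trapezoid ((kernel_continuousOn α _).mono hsub)
    ((kernel_convexOn h.pos.le _).subset hsub (convex_Icc _ _)) (h.mesh_strictMono j.lt_succ_self)
  rw [aCoeff_of_lt α T r N hj]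
  refine (mul_le_mul_of_nonneg_left hk h.gamma_pos.le).trans_eq ?_
  simp only [nodeKernel]
  ring

/-! ### Two-sided bounds for the weights by kernel values -/

lemma step_mul_gCoeff (h : IsAdmissible α T r N) (hj : j ≤ m) :
    (meshPt T r N (j + 1) - meshPt T r N j) * gCoeff α T r N (m + 1) (j + 1) =
      aCoeff α T r N (m + 1) (j + 1)
      + (if j = 0 then 0 else bCoeff α T r N (m + 1) j)
      - (if j = m then 0 else bCoeff α T r N (m + 1) (j + 1)) := by
  rw [gCoeff_succ α T r N hj, mul_inv_cancel_left₀ (h.step_pos j).ne']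

lemma bCoeff_prev_nonneg (h : IsAdmissible α T r N) (hj : j ≤ m) :
    0 ≤ if j = 0 then 0 else bCoeff α T r N (m + 1) j := by
  rcases j with _ | i
  · simp
  · simpa using h.bCoeff_nonneg (by omega)

lemma aCoeff_le_step_mul_gCoeff_self (h : IsAdmissible α T r N) (m : ℕ) :
    aCoeff α T r N (m + 1) (m + 1) ≤
      (meshPt T r N (m + 1) - meshPt T r N m) * gCoeff α T r N (m + 1) (m + 1) := by
  rw [h.step_mul_gCoeff le_rfl, if_pos rfl, sub_zero]
  exact le_add_of_nonneg_right (h.bCoeff_prev_nonneg le_rfl)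

lemma mul_nodeKernel_le_gCoeff_self (h : IsAdmissible α T r N) (m : ℕ) :
    (1 - α / 2) * nodeKernel α T r N (m + 1) m ≤
      (1 - α) * gCoeff α T r N (m + 1) (m + 1) := by
  refine le_of_mul_le_mul_left ?_ (h.step_pos m)
  have := mul_le_mul_of_nonneg_left (h.aCoeff_le_step_mul_gCoeff_self m)
    (sub_pos.2 h.lt_one).le
  rw [h.aCoeff_self] at this
  linarith

lemma add_le_step_mul_gCoeff (h : IsAdmissible α T r N) (hj : j < m) :
    (aCoeff α T r N (m + 1) (j + 1) + (meshPt T r N (j + 1) - meshPt T r N j) *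
      nodeKernel α T r N (m + 1) j) / 2 ≤
      (meshPt T r N (j + 1) - meshPt T r N j) * gCoeff α T r N (m + 1) (j + 1) := by
  rw [h.step_mul_gCoeff hj.le, if_neg hj.ne]
  linarith [h.bCoeff_prev_nonneg hj.le, h.bCoeff_le_left hj]

lemma step_mul_nodeKernel_le_aCoeff (h : IsAdmissible α T r N) (hj : j < m) :
    (meshPt T r N (j + 1) - meshPt T r N j) * nodeKernel α T r N (m + 1) j ≤
      aCoeff α T r N (m + 1) (j + 1) := by
  linarith [h.bCoeff_nonneg hj, h.bCoeff_le_left hj]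

lemma nodeKernel_le_gCoeff (h : IsAdmissible α T r N) (hj : j ≤ m) :
    nodeKernel α T r N (m + 1) j ≤ gCoeff α T r N (m + 1) (j + 1) := by
  rcases hj.eq_or_lt with rfl | hj
  · have := h.mul_nodeKernel_le_gCoeff_self j
    have h0 := h.pos
    have h1 := h.lt_one
    have hk := (h.nodeKernel_pos (le_refl j)).le
    refine le_of_mul_le_mul_left (le_trans ?_ this) (sub_pos.2 h1)
    exact mul_le_mul_of_nonneg_right (by linarith) hk
  · refine le_of_mul_le_mul_left ?_ (h.step_pos j)
    linarith [h.add_le_step_mul_gCoeff hj, h.step_mul_nodeKernel_le_aCoeff hj]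

/-- The trapezoidal bound puts a_{n,j} below τ_j k_j by at least τ_j (k_j - k_{j-1}) / 2, and the
correction from the previous cell uses up at most half of this gap. -/
lemma gCoeff_le_nodeKernel (h : IsAdmissible α T r N) (hj : j < m) :
    gCoeff α T r N (m + 1) (j + 1) ≤ nodeKernel α T r N (m + 1) (j + 1) := by
  refine le_of_mul_le_mul_left ?_ (h.step_pos j)
  have h1 := h.step_pos j
  have hb := h.bCoeff_nonneg hj
  have ha := h.aCoeff_le hj
  have hmono := h.nodeKernel_mono (Nat.succ_le_of_lt hj)
  rw [h.step_mul_gCoeff hj.le, if_neg hj.ne]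
  have hprev : (if j = 0 then 0 else bCoeff α T r N (m + 1) j) ≤
      (meshPt T r N (j + 1) - meshPt T r N j) / 4 *
        (nodeKernel α T r N (m + 1) (j + 1) - nodeKernel α T r N (m + 1) j) := by
    rcases j with _ | i
    · simp only [if_true]
      exact mul_nonneg (by linarith) (sub_nonneg.2 hmono)
    · rw [if_neg i.succ_ne_zero]
      refine (h.bCoeff_le_right (by omega)).trans ?_
      exact mul_le_mul_of_nonneg_right (by linarith [h.step_mono i]) (sub_nonneg.2 hmono)
  nlinarith [mul_nonneg h1.le (sub_nonneg.2 hmono)]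

lemma gCoeff_nonneg (h : IsAdmissible α T r N) (hj : j ≤ m) :
    0 ≤ gCoeff α T r N (m + 1) (j + 1) :=
  (h.nodeKernel_pos hj).le.trans (h.nodeKernel_le_gCoeff hj)

lemma gCoeff_mono (h : IsAdmissible α T r N) (hj : j < m) :
    gCoeff α T r N (m + 1) (j + 1) ≤ gCoeff α T r N (m + 1) (j + 2) :=
  (h.gCoeff_le_nodeKernel hj).trans (h.nodeKernel_le_gCoeff hj)

lemma gCoeff_last (h : IsAdmissible α T r N) (m : ℕ) :
    (1 - α / 2) * gCoeff α T r N (m + 2) (m + 1) ≤ (1 - α) * gCoeff α T r N (m + 2) (m + 2) :=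
  (mul_le_mul_of_nonneg_left (h.gCoeff_le_nodeKernel m.lt_succ_self)
    (by linarith [h.lt_one])).trans (h.mul_nodeKernel_le_gCoeff_self (m + 1))

/-- The kernel here is centred at t_n rather than t_{n-σ}, so that the Beta integral over [0, t_n]
applies. On earlier cells the shift only lowers the kernel, and a_{n,j} ≤ 2 τ_j g_{n,j}; on the last
cell the factor 2 suffices because 2 (1 - σ) ≥ 1. -/
lemma integral_le_gCoeff (h : IsAdmissible α T r N) (hj : j ≤ m) :
    1 / Real.Gamma (1 - α) * ((meshPt T r N (j + 1) - meshPt T r N j)⁻¹ *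
      ∫ x in (meshPt T r N j)..(meshPt T r N (j + 1)), (meshPt T r N (m + 1) - x) ^ (-α)) ≤
      2 * gCoeff α T r N (m + 1) (j + 1) := by
  have hτ := h.step_pos j
  refine le_of_mul_le_mul_left ?_ hτ
  rw [mul_left_comm, mul_inv_cancel_left₀ hτ.ne']
  rcases hj.eq_or_lt with rfl | hj
  · have h1 := sub_pos.2 h.lt_one
    have h3 : 0 < 1 - α / 2 := by linarith
    have ha := h.aCoeff_self j
    have hg := h.aCoeff_le_step_mul_gCoeff_self j
    have hk : (meshPt T r N (j + 1) - meshPt T r N j) ^ (-α) ≤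
        (offsetPt α T r N (j + 1) - meshPt T r N j) ^ (-α) := by
      rw [offsetPt_succ, add_sub_cancel_left]
      refine Real.rpow_le_rpow_of_nonpos (mul_pos h3 hτ) ?_ (by linarith [h.pos])
      nlinarith [h.pos]
    rw [integral_kernel_self h.lt_one, sub_self, Real.zero_rpow h1.ne', sub_zero]
    refine le_of_mul_le_mul_left ?_ h1
    have e : (meshPt T r N (j + 1) - meshPt T r N j) ^ (1 - α) =
        (meshPt T r N (j + 1) - meshPt T r N j) *
          (meshPt T r N (j + 1) - meshPt T r N j) ^ (-α) := by
      rw [show 1 - α = -α + 1 by ring, Real.rpow_add_one hτ.ne', mul_comm]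
    have h4 := mul_le_mul_of_nonneg_left hk (mul_nonneg hτ.le h.gamma_pos.le)
    have h5 := mul_le_mul_of_nonneg_left hg h1.le
    have h6 := mul_pos hτ (h.nodeKernel_pos (le_refl j))
    have h7 : (1 - α) * (1 / Real.Gamma (1 - α) *
        ((meshPt T r N (j + 1) - meshPt T r N j) ^ (1 - α) / (1 - α))) =
        (meshPt T r N (j + 1) - meshPt T r N j) * (1 / Real.Gamma (1 - α)) *
          (meshPt T r N (j + 1) - meshPt T r N j) ^ (-α) := by
      rw [e]
      field_simp
    rw [h7]
    rw [nodeKernel] at h6 ha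
    nlinarith [h.lt_one]
  · have hb := h.add_le_step_mul_gCoeff hj
    have hk := mul_nonneg hτ.le (h.nodeKernel_pos hj.le).le
    have hle := h.mesh_strictMono.monotone j.le_succ
    have hi : ∫ x in (meshPt T r N j)..(meshPt T r N (j + 1)), (meshPt T r N (m + 1) - x) ^ (-α) ≤
        ∫ x in (meshPt T r N j)..(meshPt T r N (j + 1)),
          (offsetPt α T r N (m + 1) - x) ^ (-α) := by
      refine integral_mono_on hle (intervalIntegrable_kernel h.lt_one _ _ _)
        (intervalIntegrable_kernel h.lt_one _ _ _) fun x hx => ?_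
      have := offsetPt_le_meshPt h.time_pos h.one_le_grading h.one_le_steps h.pos m
      exact Real.rpow_le_rpow_of_nonpos
        (sub_pos.2 (h.Icc_subset_Iio (Nat.succ_le_of_lt hj) j hx)) (by linarith) (by linarith [h.pos])
    have := mul_le_mul_of_nonneg_left hi h.gamma_pos.le
    rw [← aCoeff_of_lt α T r N hj] at this
    linarith

end IsAdmissible

end Weights

end FracNonlocal

namespace FracNonlocal

/-! ### Energy inequality and comparison principle -/

/-- Summation by parts: apart from the top term, every e j enters with a nonpositive coefficient. -/
lemma sum_mul_sub_le {γ e : ℕ → ℝ} (m : ℕ) (h0 : 0 ≤ γ 0) (hγ : ∀ j < m, γ j ≤ γ (j + 1))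
    (he : ∀ j ≤ m, 0 ≤ e j) :
    ∑ j ∈ Finset.range (m + 1), γ j * (e (j + 1) - e j) ≤ γ m * e (m + 1) := by
  induction m with
  | zero =>
    simp only [zero_add, Finset.range_one, Finset.sum_singleton]
    nlinarith [mul_nonneg h0 (he 0 le_rfl)]
  | succ m ih =>
    rw [Finset.sum_range_succ]
    have := ih (fun j hj => hγ j (by omega)) (fun j hj => he j (by omega))
    nlinarith [mul_nonneg (sub_nonneg.2 (hγ m (by omega))) (he (m + 1) le_rfl)]

lemma discreteCaputo_eq_sum_range {V : Type*} [AddCommGroup V] [Module ℝ V]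
    (α T r : ℝ) (N : ℕ) (U : ℕ → V) (n : ℕ) :
    discreteCaputo α T r N U n =
      ∑ j ∈ Finset.range n, gCoeff α T r N n (j + 1) • (U (j + 1) - U j) := by
  rw [discreteCaputo, Finset.range_eq_Ico, ← Finset.Ico_add_one_right_eq_Icc,
    ← Finset.sum_Ico_add' (fun j => gCoeff α T r N n j • (U j - U (j - 1))) 0 n 1]
  simp

namespace IsAdmissible

variable {α T r : ℝ} {N : ℕ}

lemma energy_le {V : Type*} [AddCommGroup V] [Module ℝ V] (h : IsAdmissible α T r N)
    (B : LinearMap.BilinForm ℝ V) (hs : ∀ x y, B x y = B y x) (hB : ∀ x, 0 ≤ B x x)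
    (U : ℕ → V) (m : ℕ) :
    discreteCaputo α T r N (fun j => B (U j) (U j)) (m + 1) ≤
      2 * B (discreteCaputo α T r N U (m + 1)) (weightedValue α U (m + 1)) := by
  set W := weightedValue α U (m + 1) with hW
  set δ := U (m + 1) - U m with hδ
  have h0 := h.pos
  have h1 := h.lt_one
  have hlast : B (U (m + 1) - W) (U (m + 1) - W) = (α / 2) ^ 2 * B δ δ := by
    have : U (m + 1) - W = (α / 2) • δ := by
      rw [hW, weightedValue, hδ, Nat.add_sub_cancel]; module
    rw [this]; simp; ring
  have hprev : B (U m - W) (U m - W) = (1 - α / 2) ^ 2 * B δ δ := by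
    have : U m - W = (-(1 - α / 2)) • δ := by
      rw [hW, weightedValue, hδ, Nat.add_sub_cancel]; module
    rw [this]; simp only [map_smul, LinearMap.smul_apply, smul_eq_mul]; ring
  -- Recentring at W turns the claim into this sum. Its last term is -(1 - α) g_{n,n} B δ δ, because
  -- σ² - (1 - σ)² = -(1 - α). By Abel summation the other terms contribute at most (1 - σ)²
  -- g_{n,n-1} B δ δ, which `gCoeff_last` absorbs.
  have key : ∑ j ∈ Finset.range (m + 1), gCoeff α T r N (m + 1) (j + 1) *
      (B (U (j + 1) - W) (U (j + 1) - W) - B (U j - W) (U j - W)) ≤ 0 := by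
    have hg := h.gCoeff_nonneg (le_refl m)
    rw [Finset.sum_range_succ, hlast, hprev]
    rcases m with _ | m
    · simp only [Finset.range_zero, Finset.sum_empty, zero_add]
      nlinarith [mul_nonneg hg (hB δ), mul_nonneg (mul_nonneg hg (hB δ)) (sub_nonneg.2 h1.le)]
    · have hsum := sum_mul_sub_le (γ := fun j => gCoeff α T r N (m + 2) (j + 1))
        (e := fun j => B (U j - W) (U j - W)) m (h.gCoeff_nonneg (Nat.zero_le _))
        (fun j hj => h.gCoeff_mono (by omega)) (fun j _ => hB _)
      simp only [hprev] at hsum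
      have hl := h.gCoeff_last m
      have hg' := h.gCoeff_nonneg (by omega : m ≤ m + 1)
      have h2 : (1 - α / 2) ^ 2 * gCoeff α T r N (m + 2) (m + 1) ≤
          (1 - α) * gCoeff α T r N (m + 2) (m + 2) := by
        refine le_trans (mul_le_mul_of_nonneg_right ?_ hg') hl
        nlinarith
      have h3 := mul_le_mul_of_nonneg_right h2 (hB δ)
      refine (add_le_add_left hsum _).trans ?_
      nlinarith
  have e : ∀ j, 2 * B (U (j + 1) - U j) W - (B (U (j + 1)) (U (j + 1)) - B (U j) (U j)) =
      -(B (U (j + 1) - W) (U (j + 1) - W) - B (U j - W) (U j - W)) := by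
    intro j
    simp only [map_sub, LinearMap.sub_apply]
    rw [hs W (U (j + 1)), hs W (U j)]
    ring
  rw [← sub_nonneg, discreteCaputo_eq_sum_range, discreteCaputo_eq_sum_range, map_sum,
    LinearMap.sum_apply, Finset.mul_sum, ← Finset.sum_sub_distrib]
  simp only [map_smul, LinearMap.smul_apply, smul_eq_mul]
  rw [← neg_nonpos, ← Finset.sum_neg_distrib]
  refine le_trans (le_of_eq (Finset.sum_congr rfl fun j _ => ?_)) key
  linear_combination (-gCoeff α T r N (m + 1) (j + 1)) * e j

/-- Solved for the newest value, D x ≤ 0 bounds it by earlier values with nonnegative coefficients,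
since the weights are nondecreasing. -/
lemma nonpos_of_discreteCaputo_nonpos (h : IsAdmissible α T r N) {x : ℕ → ℝ} {M : ℕ}
    (h0 : x 0 ≤ 0) (hx : ∀ n ∈ Finset.Icc 1 M, discreteCaputo α T r N x n ≤ 0) :
    ∀ n ≤ M, x n ≤ 0 := by
  intro n
  induction n using Nat.strong_induction_on with
  | _ n ih =>
    intro hn
    rcases n with _ | m
    · exact h0
    have hD := hx (m + 1) (Finset.mem_Icc.2 ⟨by omega, hn⟩)
    rw [discreteCaputo_eq_sum_range, Finset.sum_range_succ] at hD
    simp only [smul_eq_mul] at hD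
    have hg : 0 < gCoeff α T r N (m + 1) (m + 1) :=
      (h.nodeKernel_pos le_rfl).trans_le (h.nodeKernel_le_gCoeff le_rfl)
    have hxm := ih m (by omega) (by omega)
    suffices gCoeff α T r N (m + 1) (m + 1) * x (m + 1) ≤ 0 from
      nonpos_of_mul_nonpos_right this hg
    rcases m with _ | m
    · simp only [Finset.range_zero, Finset.sum_empty, zero_add] at hD ⊢ hg
      nlinarith [mul_nonneg hg.le (neg_nonneg.2 h0)]
    · have hsum := sum_mul_sub_le (γ := fun j => gCoeff α T r N (m + 2) (j + 1))
        (e := fun j => -x j) m (h.gCoeff_nonneg (Nat.zero_le _))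
        (fun j hj => h.gCoeff_mono (by omega))
        (fun j hj => neg_nonneg.2 (ih j (by omega) (by omega)))
      have e : ∑ j ∈ Finset.range (m + 1), gCoeff α T r N (m + 2) (j + 1) * (-x (j + 1) - -x j) =
          -∑ j ∈ Finset.range (m + 1), gCoeff α T r N (m + 2) (j + 1) * (x (j + 1) - x j) := by
        rw [← Finset.sum_neg_distrib]
        exact Finset.sum_congr rfl fun j _ => by ring
      rw [e] at hsum
      have hmono := h.gCoeff_mono (by omega : m < m + 1)
      nlinarith [mul_nonneg (sub_nonneg.2 hmono) (neg_nonneg.2 hxm)]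

lemma one_le_discreteCaputo_rpow (h : IsAdmissible α T r N) (m : ℕ) :
    1 ≤ discreteCaputo α T r N
      (fun j => 2 / Real.Gamma (1 + α) * meshPt T r N j ^ α) (m + 1) := by
  have hΓ : 0 < Real.Gamma (1 + α) := Real.Gamma_pos_of_pos (by linarith [h.pos])
  have hΓα := Real.Gamma_add_one h.pos.ne'
  have hz := meshPt_zero (T := T) (N := N) h.one_le_grading
  have hpos : 0 < meshPt T r N (m + 1) := hz ▸ h.mesh_strictMono m.succ_pos
  set t := meshPt T r N (m + 1) with ht
  set p : ℝ → ℝ := fun x => (t - x) ^ (-α) * x ^ (α - 1) with hp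
  have hint : ∀ j < m + 1,
      IntervalIntegrable p volume (meshPt T r N j) (meshPt T r N (j + 1)) := by
    intro j hj
    refine (intervalIntegrable_beta_kernel h.pos h.lt_one hpos).mono_set ?_
    rw [uIcc_of_le hpos.le, uIcc_of_le (h.mesh_strictMono.monotone j.le_succ)]
    exact Icc_subset_Icc (meshPt_nonneg h.time_pos j) (h.mesh_strictMono.monotone hj)
  have hsum := sum_integral_adjacent_intervals hint
  rw [hz, ← ht, hp, integral_beta_kernel h.pos h.lt_one hpos] at hsum
  have hterm : ∀ j ∈ Finset.range (m + 1),
      1 / Real.Gamma (1 - α) * (α * ∫ x in (meshPt T r N j)..(meshPt T r N (j + 1)), p x) ≤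
        2 * (gCoeff α T r N (m + 1) (j + 1) *
          (meshPt T r N (j + 1) ^ α - meshPt T r N j ^ α)) := by
    intro j hj
    have hj' : j ≤ m := by simpa [Nat.lt_succ_iff] using hj
    have hlt := h.mesh_strictMono j.lt_succ_self
    have h1 := integral_beta_kernel_le h.pos h.lt_one (meshPt_nonneg h.time_pos j) hlt
      (h.mesh_strictMono.monotone (Nat.succ_le_succ hj') : _ ≤ t)
    have h2 := sub_nonneg.2 (Real.rpow_le_rpow (meshPt_nonneg h.time_pos j) hlt.le h.pos.le)
    refine (mul_le_mul_of_nonneg_left h1 h.gamma_pos.le).trans ?_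
    have h3 := mul_le_mul_of_nonneg_right (h.integral_le_gCoeff hj') h2
    linarith
  have htot := Finset.sum_le_sum hterm
  rw [← Finset.mul_sum, ← Finset.mul_sum, ← Finset.mul_sum, hsum] at htot
  rw [discreteCaputo_eq_sum_range]
  have e : ∑ j ∈ Finset.range (m + 1), gCoeff α T r N (m + 1) (j + 1) •
      (2 / Real.Gamma (1 + α) * meshPt T r N (j + 1) ^ α -
        2 / Real.Gamma (1 + α) * meshPt T r N j ^ α) =
      (2 * ∑ j ∈ Finset.range (m + 1), gCoeff α T r N (m + 1) (j + 1) *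
        (meshPt T r N (j + 1) ^ α - meshPt T r N j ^ α)) / Real.Gamma (1 + α) := by
    rw [Finset.mul_sum, Finset.sum_div]
    exact Finset.sum_congr rfl fun j _ => by rw [smul_eq_mul]; ring
  rw [e, le_div_iff₀ hΓ, one_mul]
  refine le_trans (le_of_eq ?_) htot
  -- The cellwise Beta integrals add up to α Γ(α) = Γ(1 + α) once the factor Γ(1 - α) cancels.
  rw [add_comm, hΓα]
  have := (Real.Gamma_pos_of_pos (sub_pos.2 h.lt_one)).ne'
  field_simp

/-- A discrete fractional comparison estimate. -/
lemma le_of_discreteCaputo_le (h : IsAdmissible α T r N) {y : ℕ → ℝ} {R : ℝ} {M : ℕ} (hR : 0 ≤ R)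
    (hy : ∀ n ∈ Finset.Icc 1 M, discreteCaputo α T r N y n ≤ R) :
    ∀ n ≤ M, y n ≤ y 0 + 2 * R * (meshPt T r N n ^ α / Real.Gamma (1 + α)) := by
  intro n hn
  -- Compare y with y 0 plus R times the barrier, which vanishes at t_0 = 0.
  have := h.nonpos_of_discreteCaputo_nonpos (M := M)
    (x := fun j => y j - y 0 - R * (2 / Real.Gamma (1 + α) * meshPt T r N j ^ α)) ?_ ?_ n hn
  · have e : 2 * R * (meshPt T r N n ^ α / Real.Gamma (1 + α)) =
      R * (2 / Real.Gamma (1 + α) * meshPt T r N n ^ α) := by ring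
    rw [e]
    linarith
  · simp [meshPt_zero h.one_le_grading, Real.zero_rpow h.pos.ne']
  · intro k hk
    obtain ⟨m, rfl⟩ : ∃ m, k = m + 1 := ⟨k - 1, by have := (Finset.mem_Icc.1 hk).1; omega⟩
    have h1 := hy _ hk
    have h2 := mul_le_mul_of_nonneg_left (h.one_le_discreteCaputo_rpow m) hR
    rw [mul_one] at h2
    rw [discreteCaputo_eq_sum_range] at h1 h2 ⊢
    rw [Finset.mul_sum] at h2
    have := h1.trans h2
    rw [← sub_nonpos, ← Finset.sum_sub_distrib] at this
    refine le_trans (le_of_eq (Finset.sum_congr rfl fun j _ => ?_)) this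
    simp only [smul_eq_mul]
    ring

end IsAdmissible

end FracNonlocal

namespace FracNonlocal

/-! ### A priori bounds in an inner product space -/

lemma map_discreteCaputo {V W : Type*} [AddCommGroup V] [Module ℝ V] [AddCommGroup W] [Module ℝ W]
    (G : V →ₗ[ℝ] W) (α T r : ℝ) (N : ℕ) (U : ℕ → V) (n : ℕ) :
    G (discreteCaputo α T r N U n) = discreteCaputo α T r N (fun j => G (U j)) n := by
  simp [discreteCaputo]

lemma map_weightedValue {V W : Type*} [AddCommGroup V] [Module ℝ V] [AddCommGroup W] [Module ℝ W]
    (G : V →ₗ[ℝ] W) (α : ℝ) (U : ℕ → V) (n : ℕ) :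
    G (weightedValue α U n) = weightedValue α (fun j => G (U j)) n := by
  simp [weightedValue]

namespace IsAdmissible

variable {α T r : ℝ} {N : ℕ} {H : Type*} [NormedAddCommGroup H] [InnerProductSpace ℝ H]

lemma discreteCaputo_norm_sq_le (h : IsAdmissible α T r N) (u : ℕ → H) (n : ℕ) (hn : 1 ≤ n) :
    discreteCaputo α T r N (fun j => ‖u j‖ ^ 2) n ≤
      2 * inner ℝ (discreteCaputo α T r N u n) (weightedValue α u n) := by
  obtain ⟨m, rfl⟩ : ∃ m, n = m + 1 := ⟨n - 1, by omega⟩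
  have := h.energy_le (innerₗ H) (fun x y => real_inner_comm _ _)
    (fun x => real_inner_self_nonneg) u m
  simpa [innerₗ_apply_apply, real_inner_self_eq_norm_sq] using this

lemma norm_sq_le (h : IsAdmissible α T r N) {u : ℕ → H} {Φ : ℝ} {M : ℕ} (hΦ : 0 ≤ Φ)
    (hu : ∀ n ∈ Finset.Icc 1 M,
      inner ℝ (discreteCaputo α T r N u n) (weightedValue α u n) ≤ Φ) :
    ‖u M‖ ^ 2 ≤ ‖u 0‖ ^ 2 + 4 * Φ * (meshPt T r N M ^ α / Real.Gamma (1 + α)) := by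
  have := h.le_of_discreteCaputo_le (y := fun j => ‖u j‖ ^ 2) (R := 2 * Φ) (M := M)
    (by positivity) (fun n hn => (h.discreteCaputo_norm_sq_le u n (Finset.mem_Icc.1 hn).1).trans
      (mul_le_mul_of_nonneg_left (hu n hn) zero_le_two)) M le_rfl
  linarith

lemma norm_weightedValue_le (h : IsAdmissible α T r N) {u : ℕ → H} {S : ℝ} {n : ℕ}
    (h1 : ‖u n‖ ≤ S) (h2 : ‖u (n - 1)‖ ≤ S) : ‖weightedValue α u n‖ ≤ S := by
  have hα0 := h.pos
  have hα1 := h.lt_one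
  refine (norm_add_le _ _).trans ?_
  rw [norm_smul, norm_smul, Real.norm_of_nonneg (by linarith), Real.norm_of_nonneg (by linarith)]
  nlinarith

/-- At an index m where the norm is maximal up to M, the right-hand side is at most Φ ‖u m‖; the
bound on squares can then be divided by ‖u m‖. -/
lemma norm_le (h : IsAdmissible α T r N) {u : ℕ → H} {Φ : ℝ} {M : ℕ} (hΦ : 0 ≤ Φ)
    (hu : ∀ n ∈ Finset.Icc 1 M, inner ℝ (discreteCaputo α T r N u n) (weightedValue α u n) ≤
      Φ * ‖weightedValue α u n‖) :
    ‖u M‖ ≤ ‖u 0‖ + 4 * Φ * (meshPt T r N M ^ α / Real.Gamma (1 + α)) := by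
  obtain ⟨m, hm, hmax⟩ := Finset.exists_max_image (Finset.range (M + 1)) (fun j => ‖u j‖)
    ⟨0, by simp⟩
  have hmM : m ≤ M := by simpa [Nat.lt_succ_iff] using hm
  have hle : ∀ j ≤ M, ‖u j‖ ≤ ‖u m‖ := fun j hj => hmax j (by simpa [Nat.lt_succ_iff] using hj)
  have hΓ : 0 < Real.Gamma (1 + α) := Real.Gamma_pos_of_pos (by linarith [h.pos])
  have hz : meshPt T r N m ^ α / Real.Gamma (1 + α) ≤ meshPt T r N M ^ α / Real.Gamma (1 + α) :=
    div_le_div_of_nonneg_right (Real.rpow_le_rpow (meshPt_nonneg h.time_pos m)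
      (h.mesh_strictMono.monotone hmM) h.pos.le) hΓ.le
  have hz0 : 0 ≤ meshPt T r N M ^ α / Real.Gamma (1 + α) :=
    div_nonneg (Real.rpow_nonneg (meshPt_nonneg h.time_pos M) _) hΓ.le
  refine (hle M le_rfl).trans ?_
  rcases (norm_nonneg (u m)).eq_or_lt with h0 | hS
  · rw [← h0]; positivity
  have hsq := h.norm_sq_le (u := u) (Φ := Φ * ‖u m‖) (M := m) (by positivity) fun n hn => by
    have hn' := Finset.mem_Icc.1 hn
    exact (hu n (Finset.mem_Icc.2 ⟨hn'.1, hn'.2.trans hmM⟩)).trans (mul_le_mul_of_nonneg_left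
      (h.norm_weightedValue_le (hle n (by omega)) (hle _ (by omega))) hΦ)
  refine le_of_mul_le_mul_left ?_ hS
  have h1 := mul_le_mul_of_nonneg_left (hle 0 (Nat.zero_le _)) (norm_nonneg (u 0))
  have h2 := mul_le_mul_of_nonneg_left hz (mul_nonneg (mul_nonneg zero_le_four hΦ) hS.le)
  nlinarith

end IsAdmissible

/-- The a priori bounds for an abstract scheme, `G₀` standing for the embedding into `L²` and `G₁`
for the gradient. -/
lemma IsAdmissible.apriori_bounds {α T r : ℝ} {N : ℕ} (h : IsAdmissible α T r N)
    {V H₀ H₁ : Type*} [AddCommGroup V] [Module ℝ V] [NormedAddCommGroup H₀]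
    [InnerProductSpace ℝ H₀] [NormedAddCommGroup H₁] [InnerProductSpace ℝ H₁]
    (G₀ : V →ₗ[ℝ] H₀) (G₁ : V →ₗ[ℝ] H₁) {U : ℕ → V} {c : ℕ → ℝ} {φ : ℕ → H₀} {m₁ Φ : ℝ} {M : ℕ}
    (hm₁ : 0 < m₁) (hc : ∀ n, m₁ ≤ c n) (hφ : ∀ n ∈ Finset.Icc 1 M, ‖φ n‖ ≤ Φ) (hΦ : 0 ≤ Φ)
    (hU : ∀ n ∈ Finset.Icc 1 M, ∀ v, inner ℝ (G₀ (discreteCaputo α T r N U n)) (G₀ v) +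
      c n * inner ℝ (G₁ (weightedValue α U n)) (G₁ v) = inner ℝ (φ n) (G₀ v)) :
    ‖G₀ (U M)‖ ≤ ‖G₀ (U 0)‖ + 4 * Φ * (meshPt T r N M ^ α / Real.Gamma (1 + α)) ∧
    ‖G₁ (U M)‖ ^ 2 ≤
      ‖G₁ (U 0)‖ ^ 2 + Φ ^ 2 / m₁ * (meshPt T r N M ^ α / Real.Gamma (1 + α)) := by
  constructor
  -- Test with the weighted value; the diffusion term is nonnegative and is dropped.
  · refine h.norm_le (u := fun j => G₀ (U j)) hΦ fun n hn => ?_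
    rw [← map_discreteCaputo, ← map_weightedValue]
    have h1 := hU n hn (weightedValue α U n)
    have h2 := mul_nonneg (hm₁.le.trans (hc n))
      (real_inner_self_nonneg (x := G₁ (weightedValue α U n)))
    have h3 := (real_inner_le_norm (φ n) (G₀ (weightedValue α U n))).trans
      (mul_le_mul_of_nonneg_right (hφ n hn) (norm_nonneg _))
    linarith
  -- Test with the discrete derivative D: c I = (φ, D) - ‖D‖² ≤ Φ ‖D‖ - ‖D‖² ≤ Φ² / 4, and c ≥ m₁
  -- when I ≥ 0.
  · have := h.norm_sq_le (u := fun j => G₁ (U j)) (Φ := Φ ^ 2 / (4 * m₁)) (M := M) (by positivity)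
      fun n hn => ?_
    · refine this.trans_eq ?_
      field_simp
    · rw [← map_discreteCaputo, ← map_weightedValue]
      have h1 := hU n hn (discreteCaputo α T r N U n)
      have h3 := (real_inner_le_norm (φ n) (G₀ (discreteCaputo α T r N U n))).trans
        (mul_le_mul_of_nonneg_right (hφ n hn) (norm_nonneg _))
      rw [real_inner_self_eq_norm_sq] at h1
      rw [real_inner_comm]
      set I := inner ℝ (G₁ (weightedValue α U n)) (G₁ (discreteCaputo α T r N U n))
      rw [le_div_iff₀ (by positivity)]
      rcases le_total I 0 with hI | hI
      · exact (mul_nonpos_of_nonpos_of_nonneg hI (by positivity)).trans (sq_nonneg _)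
      · nlinarith [mul_le_mul_of_nonneg_right (hc n) hI,
          sq_nonneg (Φ - 2 * ‖G₀ (discreteCaputo α T r N U n)‖)]

/-! ### The constants -/

/-- Keep only the part of the Gamma integral over [R, R + 1]. The free R makes Γ beat any prescribed
geometric growth. -/
lemma rpow_mul_exp_le_Gamma {R s : ℝ} (hR : 0 < R) (hs : 0 ≤ s) :
    R ^ s * Real.exp (-(R + 1)) ≤ Real.Gamma (s + 1) := by
  rw [Real.Gamma_eq_integral (by linarith)]
  have hconv := Real.GammaIntegral_convergent (s := s + 1) (by linarith)
  rw [add_sub_cancel_right] at hconv ⊢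
  have hsub : Ioc R (R + 1) ⊆ Ioi 0 := fun x hx => hR.trans hx.1
  calc R ^ s * Real.exp (-(R + 1)) = ∫ _ in Ioc R (R + 1), R ^ s * Real.exp (-(R + 1)) := by simp
    _ ≤ ∫ x in Ioc R (R + 1), Real.exp (-x) * x ^ s := by
        refine setIntegral_mono_on (integrableOn_const (by simp)) (hconv.mono_set hsub) measurableSet_Ioc fun x hx => ?_
        rw [mul_comm]
        have h1 := Real.rpow_le_rpow hR.le hx.1.le hs
        have h2 := Real.exp_le_exp.2 (neg_le_neg hx.2)
        exact mul_le_mul h2 h1 (by positivity) (by positivity)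
    _ ≤ _ := by
        refine setIntegral_mono_set hconv ?_ hsub.eventuallyLE
        refine (ae_restrict_mem measurableSet_Ioi).mono fun x (hx : 0 < x) => ?_
        simp only [Pi.zero_apply]
        positivity

lemma mittagLeffler_term_le {α α₀ z Z : ℝ} (hα₀ : 0 < α₀) (hα : α₀ ≤ α) (hz : 0 ≤ z) (hzZ : z ≤ Z)
    (hZ : 1 ≤ Z) (k : ℕ) : z ^ k / Real.Gamma (α * k + 1) ≤
      Real.exp ((2 * Z) ^ (1 / α₀) + 1) * (1 / 2) ^ k := by
  -- With R ^ α₀ = 2 Z the Gamma factor grows at least like (2 Z) ^ k, leaving a geometric series of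
  -- ratio 1/2 that is uniform in α ≥ α₀.
  set R := (2 * Z) ^ (1 / α₀) with hRdef
  have hR1 : 1 ≤ R := Real.one_le_rpow (by linarith) (by positivity)
  have hR : 0 < R := by linarith
  have hαk : 0 ≤ α * k := mul_nonneg (hα₀.le.trans hα) k.cast_nonneg
  have h1 := rpow_mul_exp_le_Gamma hR hαk
  have h2 : (2 * Z) ^ k ≤ R ^ (α * k) := by
    calc (2 * Z) ^ k = R ^ (α₀ * k) := by
          rw [hRdef, ← Real.rpow_mul (by linarith), ← mul_assoc, one_div_mul_cancel hα₀.ne',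
            one_mul, Real.rpow_natCast]
      _ ≤ _ := Real.rpow_le_rpow_of_exponent_le hR1
          (mul_le_mul_of_nonneg_right hα k.cast_nonneg)
  rw [div_le_iff₀ (Real.Gamma_pos_of_pos (by linarith))]
  calc z ^ k ≤ Z ^ k := pow_le_pow_left₀ hz hzZ k
    _ = Real.exp (R + 1) * (1 / 2) ^ k * ((2 * Z) ^ k * Real.exp (-(R + 1))) := by
        rw [mul_mul_mul_comm, mul_comm (Real.exp _), mul_mul_mul_comm, ← mul_pow, Real.exp_neg,
          mul_inv_cancel₀ (Real.exp_ne_zero _)]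
        ring_nf
    _ ≤ _ := mul_le_mul_of_nonneg_left
        ((mul_le_mul_of_nonneg_right h2 (Real.exp_pos _).le).trans h1) (by positivity)

lemma mittagLeffler_term_nonneg {α z : ℝ} (hα : 0 < α) (hz : 0 ≤ z) (k : ℕ) :
    0 ≤ z ^ k / Real.Gamma (α * k + 1) :=
  div_nonneg (pow_nonneg hz k) (Real.Gamma_pos_of_pos (by positivity)).le

lemma summable_mittagLeffler {α z : ℝ} (hα : 0 < α) (hz : 0 ≤ z) :
    Summable fun k : ℕ => z ^ k / Real.Gamma (α * k + 1) :=
  Summable.of_nonneg_of_le (mittagLeffler_term_nonneg hα hz)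
    (mittagLeffler_term_le hα le_rfl hz (le_max_left z 1) (le_max_right z 1))
    (summable_geometric_two.mul_left _)

lemma one_le_mittagLeffler {α z : ℝ} (hα : 0 < α) (hz : 0 ≤ z) : 1 ≤ mittagLeffler α z := by
  have := (summable_mittagLeffler hα hz).le_tsum 0
    fun k _ => mittagLeffler_term_nonneg hα hz k
  simpa [mittagLeffler] using this

lemma mittagLeffler_le {α α₀ z Z : ℝ} (hα₀ : 0 < α₀) (hα : α₀ ≤ α) (hz : 0 ≤ z) (hzZ : z ≤ Z)
    (hZ : 1 ≤ Z) : mittagLeffler α z ≤ 2 * Real.exp ((2 * Z) ^ (1 / α₀) + 1) := by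
  have := (summable_mittagLeffler (hα₀.trans_le hα) hz).tsum_le_tsum
    (mittagLeffler_term_le hα₀ hα hz hzZ hZ) (summable_geometric_two.mul_left _)
  rw [tsum_mul_left, tsum_geometric_two] at this
  rw [mittagLeffler]
  linarith

lemma rpow_le_max_one {α t T : ℝ} (hα0 : 0 ≤ α) (hα1 : α ≤ 1) (ht : 0 ≤ t) (htT : t ≤ T) :
    t ^ α ≤ max 1 T :=
  (Real.rpow_le_rpow ht (htT.trans (le_max_right 1 T)) hα0).trans
    ((Real.rpow_le_rpow_of_exponent_le (le_max_left 1 T) hα1).trans_eq (Real.rpow_one _))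

/-- A bound of both constants that is uniform in the discretisation and for `α₀ ≤ α < 1`. -/
noncomputable def robustConst (T m₁ α₀ F : ℝ) : ℝ :=
  4 * Real.exp ((2 * (11 / 2 * max 1 T)) ^ (1 / α₀) + 1) *
    max 1 ((1 + 1 / Real.sqrt m₁) * (11 * max 1 T * Real.exp 2 / 4 + 1) * |F|)

lemma robustConst_pos (T m₁ α₀ F : ℝ) : 0 < robustConst T m₁ α₀ F :=
  mul_pos (by positivity) (lt_max_of_lt_left one_pos)

section Robust

variable {α α₀ T t F G m₁ : ℝ}

lemma source_factor_le (hα0 : 0 < α) (hα1 : α < 1) (hT : 0 < T) :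
    11 * T ^ α / (4 * Real.Gamma (1 + α)) + 1 ≤ 11 * max 1 T * Real.exp 2 / 4 + 1 := by
  have h1 := rpow_mul_exp_le_Gamma one_pos hα0.le
  rw [Real.one_rpow, one_mul, add_comm α] at h1
  have h2 := rpow_le_max_one hα0.le hα1.le hT.le le_rfl
  have hΓ : 0 < Real.Gamma (1 + α) := Real.Gamma_pos_of_pos (by linarith)
  have h3 : 1 ≤ Real.exp 2 * Real.Gamma (1 + α) := by
    calc (1 : ℝ) = Real.exp 2 * Real.exp (-(1 + 1)) := by rw [← Real.exp_add]; norm_num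
      _ ≤ _ := mul_le_mul_of_nonneg_left h1 (Real.exp_pos _).le
  have hm : 0 ≤ max 1 T := zero_le_one.trans (le_max_left _ _)
  rw [add_le_add_iff_right, div_le_div_iff₀ (by positivity) (by norm_num)]
  nlinarith [mul_le_mul_of_nonneg_left h3 hm]

lemma const_le_robustConst (hα₀ : 0 < α₀) (hα : α₀ ≤ α) (hα1 : α < 1) (hT : 0 < T) (ht : 0 ≤ t)
    (htT : t ≤ T) (hG : 0 ≤ G) (hGF : G ≤ F) {κ ν : ℝ} (hκ : 0 ≤ κ) (hκ' : κ ≤ 11 / 2)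
    (hν : 0 ≤ ν) (hν' : ν ≤ 1 + 1 / Real.sqrt m₁) :
    2 * mittagLeffler α (κ * t ^ α) *
      max 1 (ν * (11 * T ^ α / (4 * Real.Gamma (1 + α)) + 1) * G) ≤ robustConst T m₁ α₀ F := by
  have hα0 := hα₀.trans_le hα
  have hΓ : 0 < Real.Gamma (1 + α) := Real.Gamma_pos_of_pos (by linarith)
  have htα := Real.rpow_nonneg ht α
  have h1 := mittagLeffler_le hα₀ hα (mul_nonneg hκ htα)
    (mul_le_mul hκ' (rpow_le_max_one hα0.le hα1.le ht htT) htα (by norm_num))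
    (by linarith [le_max_left 1 T])
  refine mul_le_mul (by linarith) (max_le_max le_rfl ?_) (zero_le_one.trans (le_max_left _ _))
    (by positivity)
  exact mul_le_mul (mul_le_mul hν' (source_factor_le hα0 hα1 hT) (by positivity)
    (hν.trans hν')) (hGF.trans (le_abs_self F)) hG
    (mul_nonneg (hν.trans hν') (by positivity))

lemma l2Const_le_robustConst (hα₀ : 0 < α₀) (hα : α₀ ≤ α) (hα1 : α < 1) (hT : 0 < T) (ht : 0 ≤ t)
    (htT : t ≤ T) (hG : 0 ≤ G) (hGF : G ≤ F) : l2Const α T t G ≤ robustConst T m₁ α₀ F := by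
  have := const_le_robustConst (m₁ := m₁) hα₀ hα hα1 hT ht htT hG hGF (κ := 11 / 4) (ν := 1)
    (by norm_num) (by norm_num) (by norm_num) (le_add_of_nonneg_right (by positivity))
  rwa [one_mul] at this

lemma gradConst_le_robustConst (hα₀ : 0 < α₀) (hα : α₀ ≤ α) (hα1 : α < 1) (hT : 0 < T)
    (ht : 0 ≤ t) (htT : t ≤ T) (hG : 0 ≤ G) (hGF : G ≤ F) :
    gradConst m₁ α T t G ≤ robustConst T m₁ α₀ F :=
  const_le_robustConst hα₀ hα hα1 hT ht htT hG hGF (by norm_num) le_rfl (by positivity)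
    (le_add_of_nonneg_left zero_le_one)

lemma div_Gamma_le (hα0 : 0 < α) (ht : 0 ≤ t) (htT : t ≤ T) :
    11 / 4 * (t ^ α / Real.Gamma (1 + α)) ≤ 11 * T ^ α / (4 * Real.Gamma (1 + α)) := by
  have hΓ : 0 < Real.Gamma (1 + α) := Real.Gamma_pos_of_pos (by linarith)
  have := Real.rpow_le_rpow ht htT hα0.le
  rw [div_mul_div_comm]
  gcongr

/-- The common shape of both stated constants, with E the Mittag-Leffler factor. -/
lemma add_le_const_mul {E B X y : ℝ} (hE : 1 ≤ E) (hX : X ≤ 2 * B) (hy : 0 ≤ y) :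
    y + X ≤ 2 * E * max 1 B * (1 + y) := by
  have h1 := le_max_left 1 B
  have h2 := le_max_right 1 B
  have h3 : max 1 B ≤ E * max 1 B := le_mul_of_one_le_left (by linarith) hE
  nlinarith [mul_le_mul_of_nonneg_right (h1.trans h3) hy]

lemma le_l2Const_mul (hα0 : 0 < α) (ht : 0 ≤ t) (htT : t ≤ T) (hG : 0 ≤ G) {x y : ℝ} (hy : 0 ≤ y)
    (hx : x ≤ y + 4 * G * (t ^ α / Real.Gamma (1 + α))) : x ≤ l2Const α T t G * (1 + y) := by
  have hΓ : 0 < Real.Gamma (1 + α) := Real.Gamma_pos_of_pos (by linarith)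
  have hz : 0 ≤ t ^ α / Real.Gamma (1 + α) := div_nonneg (Real.rpow_nonneg ht _) hΓ.le
  refine hx.trans (add_le_const_mul (one_le_mittagLeffler hα0 (by positivity)) ?_ hy)
  -- There is room to spare: 4 ≤ 2 · 11/4.
  nlinarith [mul_le_mul_of_nonneg_right (div_Gamma_le hα0 ht htT) hG, mul_nonneg hz hG]

lemma le_gradConst_mul (hm₁ : 0 < m₁) (hα0 : 0 < α) (ht : 0 ≤ t) (htT : t ≤ T) (hG : 0 ≤ G)
    {x y : ℝ} (hy : 0 ≤ y)
    (hx : x ^ 2 ≤ y ^ 2 + G ^ 2 / m₁ * (t ^ α / Real.Gamma (1 + α))) :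
    x ≤ gradConst m₁ α T t G * (1 + y) := by
  have hΓ : 0 < Real.Gamma (1 + α) := Real.Gamma_pos_of_pos (by linarith)
  have hz : 0 ≤ t ^ α / Real.Gamma (1 + α) := div_nonneg (Real.rpow_nonneg ht _) hΓ.le
  have hzX := div_Gamma_le hα0 ht htT
  set z := t ^ α / Real.Gamma (1 + α)
  have hs : (1 / Real.sqrt m₁) ^ 2 = 1 / m₁ := by rw [div_pow, Real.sq_sqrt hm₁.le, one_pow]
  have hs0 : 0 ≤ 1 / Real.sqrt m₁ := by positivity
  set s := 1 / Real.sqrt m₁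
  have hxy : x ≤ y + s * (z + 1) * G := by
    refine abs_le_of_sq_le_sq' ?_ (by positivity) |>.2
    rw [div_eq_mul_one_div, ← hs] at hx
    -- This replaces √z by z + 1, so the bound on squares becomes linear in the form of the stated
    -- constant.
    have h1 : z ≤ (z + 1) ^ 2 := by nlinarith
    have h2 := mul_le_mul_of_nonneg_left h1 (by positivity : 0 ≤ G ^ 2 * s ^ 2)
    have h3 : 0 ≤ y * (s * (z + 1) * G) := by positivity
    nlinarith
  refine hxy.trans (add_le_const_mul (one_le_mittagLeffler hα0 (by positivity)) ?_ hy)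
  have h4 : z + 1 ≤ 11 * T ^ α / (4 * Real.Gamma (1 + α)) + 1 := by linarith
  have h5 := mul_le_mul_of_nonneg_right (mul_le_mul_of_nonneg_left h4 hs0) hG
  have h6 : 0 ≤ s * (z + 1) * G := by positivity
  linarith

end Robust

lemma norm_source_le_maxSource {d : ℕ} {Ω : Set (EuclideanSpace ℝ (Fin d))}
    (f : ℝ → Lp ℝ 2 (volume.restrict Ω)) (α T r : ℝ) (N : ℕ) {n j : ℕ} (hj : j ∈ Finset.Icc 1 n) :
    ‖f (offsetPt α T r N j)‖ ≤ maxSource f α T r N n := by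
  have := Finset.le_sup (f := fun j => ‖f (offsetPt α T r N j)‖₊) hj
  exact_mod_cast this

end FracNonlocal

namespace FracNonlocal

/-! ### The finite element space -/

section FiniteElement

variable {d : ℕ} {Ω : Set (EuclideanSpace ℝ (Fin d))}
  {K : Geometry.SimplicialComplex ℝ (EuclideanSpace ℝ (Fin d))}

lemma isClosed_space (hK : IsTriangulation K Ω) : IsClosed K.space :=
  hK.finite.isClosed_biUnion fun s _ => (s.finite_toSet.isCompact_convexHull (𝕜 := ℝ)).isClosed

/-- Frontiers of convex sets are null. Off them, a point is either interior to a top-dimensional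
simplex, where v is locally affine, or in the open complement of the triangulated region, where v is
locally zero. -/
lemma exists_gradient_bound (hK : IsTriangulation K Ω) (v : feSpace Ω K) :
    ∃ C : ℝ, ∀ᵐ x, DifferentiableAt ℝ v.1 x ∧ ‖gradient v.1 x‖ ≤ C := by
  have hv0 := v.2.2.2.1
  have hvA := v.2.2.2.2
  generalize v.1 = v at hv0 hvA ⊢
  choose! A hA using hvA
  set L : Finset (EuclideanSpace ℝ (Fin d)) → (EuclideanSpace ℝ (Fin d) →L[ℝ] ℝ) :=
    fun s => (A s).linear.toContinuousLinearMap with hL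
  refine ⟨∑ s ∈ hK.finite.toFinset, ‖L s‖, ?_⟩
  have hnull : ∀ᵐ x, ∀ s ∈ K.faces, x ∉ frontier (convexHull ℝ (s : Set (EuclideanSpace ℝ (Fin d)))) := by
    rw [ae_ball_iff hK.finite.countable]
    intro s _
    exact measure_eq_zero_iff_ae_notMem.1 ((convex_convexHull ℝ (s : Set (EuclideanSpace ℝ (Fin d)))).addHaar_frontier volume)
  filter_upwards [hnull] with x hx
  have hsum : 0 ≤ ∑ s ∈ hK.finite.toFinset, ‖L s‖ := Finset.sum_nonneg fun _ _ => norm_nonneg _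
  by_cases hxK : x ∈ K.space
  · obtain ⟨s, hs, hxs⟩ := Geometry.SimplicialComplex.mem_space_iff.1 hxK
    obtain ⟨t, ht, hst, hcard⟩ := hK.pure s hs
    have hxt : x ∈ convexHull ℝ (t : Set (EuclideanSpace ℝ (Fin d))) :=
      convexHull_mono (by exact_mod_cast hst) hxs
    have hint : x ∈ interior (convexHull ℝ (t : Set (EuclideanSpace ℝ (Fin d)))) := by
      by_contra hni
      exact hx t ht ⟨subset_closure hxt, hni⟩
    have heq : v =ᶠ[nhds x] A t := by
      filter_upwards [mem_interior_iff_mem_nhds.1 hint] with y hy using hA t ht hcard y hy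
    have hd : HasFDerivAt v (L t) x := by
      refine HasFDerivAt.congr_of_eventuallyEq ?_ heq
      have := ((L t).hasFDerivAt (x := x)).add_const (A t 0)
      refine this.congr_of_eventuallyEq (Filter.Eventually.of_forall fun y => ?_)
      rw [AffineMap.decomp (A t)]
      simp [hL]
    refine ⟨hd.differentiableAt, ?_⟩
    rw [gradient, LinearIsometryEquiv.norm_map, hd.fderiv]
    exact Finset.single_le_sum (f := fun s => ‖L s‖) (fun _ _ => norm_nonneg _)
      (hK.finite.mem_toFinset.2 ht)
  · have heq : v =ᶠ[nhds x] fun _ => 0 := by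
      filter_upwards [(isClosed_space hK).isOpen_compl.mem_nhds hxK] with y hy using hv0 y hy
    have hd : HasFDerivAt v (0 : EuclideanSpace ℝ (Fin d) →L[ℝ] ℝ) x :=
      (hasFDerivAt_const 0 x).congr_of_eventuallyEq heq
    refine ⟨hd.differentiableAt, ?_⟩
    rw [gradient, LinearIsometryEquiv.norm_map, hd.fderiv, norm_zero]
    exact hsum

lemma memLp_gradient (hΩ : Bornology.IsBounded Ω) (hK : IsTriangulation K Ω) (v : feSpace Ω K) :
    MemLp (gradient v.1) 2 (volume.restrict Ω) := by
  obtain ⟨C, hC⟩ := exists_gradient_bound hK v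
  have : IsFiniteMeasure (volume.restrict Ω) := ⟨by simpa using hΩ.measure_lt_top⟩
  refine MemLp.of_bound ?_ C (ae_restrict_of_ae (hC.mono fun x hx => hx.2))
  exact (((InnerProductSpace.toDual ℝ (EuclideanSpace ℝ (Fin d))).symm.continuous.measurable).comp
    (measurable_fderiv ℝ v.1)).aestronglyMeasurable

lemma memLp_feSpace (hΩ : Bornology.IsBounded Ω) (v : feSpace Ω K) :
    MemLp v.1 2 (volume.restrict Ω) := by
  have : IsFiniteMeasure (volume.restrict Ω) := ⟨by simpa using hΩ.measure_lt_top⟩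
  obtain ⟨C, hC⟩ := hΩ.isCompact_closure.exists_bound_of_continuousOn v.2.1.continuousOn
  refine MemLp.of_bound v.2.1.aestronglyMeasurable (max C 0) (Filter.Eventually.of_forall fun x => ?_)
  by_cases hx : x ∈ Ω
  · exact (hC x (subset_closure hx)).trans (le_max_left _ _)
  · rw [v.2.2.1 x hx, norm_zero]
    exact le_max_right _ _

/-- The embedding of the finite element space into `L²(Ω)`. -/
noncomputable def toL2 (hΩ : Bornology.IsBounded Ω) :
    feSpace Ω K →ₗ[ℝ] Lp ℝ 2 (volume.restrict Ω) where
  toFun v := (memLp_feSpace hΩ v).toLp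
  map_add' _ _ := MemLp.toLp_add _ _
  map_smul' c _ := MemLp.toLp_const_smul c _

/-- The gradient as a map from the finite element space to `L²(Ω)`. -/
noncomputable def gradToL2 (hΩ : Bornology.IsBounded Ω) (hK : IsTriangulation K Ω) :
    feSpace Ω K →ₗ[ℝ] Lp (EuclideanSpace ℝ (Fin d)) 2 (volume.restrict Ω) where
  toFun v := (memLp_gradient hΩ hK v).toLp
  map_add' u v := by
    obtain ⟨_, hu⟩ := exists_gradient_bound hK u
    obtain ⟨_, hv⟩ := exists_gradient_bound hK v
    rw [← MemLp.toLp_add]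
    -- The classical gradient is additive only where both functions are differentiable, which holds
    -- almost everywhere.
    refine MemLp.toLp_congr _ _ (ae_restrict_of_ae ?_)
    filter_upwards [hu, hv] with x hux hvx
    rw [Pi.add_apply]
    simp only [gradient, Submodule.coe_add]
    rw [fderiv_add hux.1 hvx.1, map_add]
  map_smul' c v := by
    obtain ⟨_, hv⟩ := exists_gradient_bound hK v
    rw [RingHom.id_apply, ← MemLp.toLp_const_smul]
    refine MemLp.toLp_congr _ _ (ae_restrict_of_ae ?_)
    filter_upwards [hv] with x hvx
    rw [Pi.smul_apply]
    simp only [gradient, Submodule.coe_smul]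
    rw [fderiv_const_smul hvx.1, map_smul]

lemma l2Inner_eq_inner (hΩ : Bornology.IsBounded Ω) (φ : Lp ℝ 2 (volume.restrict Ω))
    (v : feSpace Ω K) : l2Inner Ω φ v = inner ℝ φ (toL2 hΩ v) := by
  rw [L2.inner_def, l2Inner]
  refine integral_congr_ae ?_
  filter_upwards [(memLp_feSpace hΩ v).coeFn_toLp] with x hx
  simp only [toL2, LinearMap.coe_mk, AddHom.coe_mk, hx]
  simp [mul_comm]

lemma l2Inner_eq_inner_toL2 (hΩ : Bornology.IsBounded Ω) (u v : feSpace Ω K) :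
    l2Inner Ω u v = inner ℝ (toL2 hΩ u) (toL2 hΩ v) := by
  rw [← l2Inner_eq_inner]
  refine integral_congr_ae ?_
  filter_upwards [(memLp_feSpace hΩ u).coeFn_toLp] with x hx
  simp only [toL2, LinearMap.coe_mk, AddHom.coe_mk, hx]

lemma gradInner_eq_inner (hΩ : Bornology.IsBounded Ω) (hK : IsTriangulation K Ω)
    (u v : feSpace Ω K) : gradInner Ω u v = inner ℝ (gradToL2 hΩ hK u) (gradToL2 hΩ hK v) := by
  rw [L2.inner_def, gradInner]
  refine integral_congr_ae ?_
  filter_upwards [(memLp_gradient hΩ hK u).coeFn_toLp, (memLp_gradient hΩ hK v).coeFn_toLp]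
    with x hx hy
  simp only [gradToL2, LinearMap.coe_mk, AddHom.coe_mk, hx, hy]

lemma l2Norm_eq_norm (hΩ : Bornology.IsBounded Ω) (u : feSpace Ω K) :
    l2Norm Ω u = ‖toL2 hΩ u‖ := by
  rw [l2Norm, l2Inner_eq_inner_toL2 hΩ, norm_eq_sqrt_real_inner]

lemma gradNorm_eq_norm (hΩ : Bornology.IsBounded Ω) (hK : IsTriangulation K Ω) (u : feSpace Ω K) :
    gradNorm Ω u = ‖gradToL2 hΩ hK u‖ := by
  rw [gradNorm, gradInner_eq_inner hΩ hK, norm_eq_sqrt_real_inner]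

end FiniteElement

end FracNonlocal

/-! ### The theorem for the finite element scheme -/

theorem mainTheorem1
    (T m₁ α₀ F : ℝ) (hT : 0 < T) (hm₁ : 0 < m₁) (hα₀ : 0 < α₀) :
    ∃ C : ℝ, 0 < C ∧
      ∀ (d : ℕ), (d = 1 ∨ d = 2) →
      ∀ (Ω : Set (EuclideanSpace ℝ (Fin d))), IsOpen Ω → IsConnected Ω → Bornology.IsBounded Ω →
      ∀ (m₂ : ℝ) (L : NNReal) (a : ℝ → ℝ), (∀ s, m₁ ≤ a s ∧ a s ≤ m₂) → LipschitzWith L a →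
      ∀ (f : ℝ → Lp ℝ 2 (volume.restrict Ω)), MemLp f 2 (volume.restrict (Set.Ioo 0 T)) →
      ∀ (K : Geometry.SimplicialComplex ℝ (EuclideanSpace ℝ (Fin d))),
        FracNonlocal.IsTriangulation K Ω →
      ∀ (α r : ℝ) (N : ℕ), 0 < α → α < 1 → 1 ≤ r → 1 ≤ N →
      ∀ (U : ℕ → FracNonlocal.feSpace Ω K),
        FracNonlocal.IsFullyDiscreteSolution Ω K a f α T r N U →
      ∀ n ∈ Finset.Icc 1 N,
        FracNonlocal.l2Norm Ω (U n) ≤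
          FracNonlocal.l2Const α T (FracNonlocal.meshPt T r N n)
            (FracNonlocal.maxSource f α T r N n) * (1 + FracNonlocal.l2Norm Ω (U 0)) ∧
        FracNonlocal.gradNorm Ω (U n) ≤
          FracNonlocal.gradConst m₁ α T (FracNonlocal.meshPt T r N n)
            (FracNonlocal.maxSource f α T r N n) * (1 + FracNonlocal.gradNorm Ω (U 0)) ∧
        (α₀ ≤ α → FracNonlocal.maxSource f α T r N n ≤ F →
          FracNonlocal.l2Const α T (FracNonlocal.meshPt T r N n)
            (FracNonlocal.maxSource f α T r N n) ≤ C ∧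
          FracNonlocal.gradConst m₁ α T (FracNonlocal.meshPt T r N n)
            (FracNonlocal.maxSource f α T r N n) ≤ C ∧
          FracNonlocal.l2Norm Ω (U n) ≤ C * (1 + FracNonlocal.l2Norm Ω (U 0)) ∧
          FracNonlocal.gradNorm Ω (U n) ≤ C * (1 + FracNonlocal.gradNorm Ω (U 0))) := by
  refine ⟨FracNonlocal.robustConst T m₁ α₀ F, FracNonlocal.robustConst_pos T m₁ α₀ F, ?_⟩
  intro d _ Ω _ _ hΩ m₂ L a ha _ f _ K hK α r N hα0 hα1 hr hN U hU n hn
  have h : FracNonlocal.IsAdmissible α T r N := ⟨hα0, hα1, hT, hr, hN⟩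
  have hn' := Finset.mem_Icc.1 hn
  have ht : 0 ≤ FracNonlocal.meshPt T r N n := FracNonlocal.meshPt_nonneg hT n
  have htT : FracNonlocal.meshPt T r N n ≤ T :=
    (h.mesh_strictMono.monotone hn'.2).trans_eq (FracNonlocal.meshPt_self hN)
  have hG : 0 ≤ FracNonlocal.maxSource f α T r N n := NNReal.coe_nonneg _
  have hbounds := h.apriori_bounds (FracNonlocal.toL2 hΩ) (FracNonlocal.gradToL2 hΩ hK) (U := U)
    (c := fun n => a (∫ x in Ω, (FracNonlocal.weightedValue α U n).1 x))
    (φ := fun n => f (FracNonlocal.offsetPt α T r N n)) (M := n) hm₁ (fun n => (ha _).1)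
    (fun j hj => FracNonlocal.norm_source_le_maxSource f α T r N hj) hG
    (fun j hj v => by
      have hj' := Finset.mem_Icc.1 hj
      rw [← FracNonlocal.l2Inner_eq_inner_toL2 hΩ, ← FracNonlocal.gradInner_eq_inner hΩ hK,
        ← FracNonlocal.l2Inner_eq_inner hΩ]
      exact hU j (Finset.mem_Icc.2 ⟨hj'.1, hj'.2.trans hn'.2⟩) v)
  rw [← FracNonlocal.l2Norm_eq_norm, ← FracNonlocal.l2Norm_eq_norm,
    ← FracNonlocal.gradNorm_eq_norm, ← FracNonlocal.gradNorm_eq_norm] at hbounds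
  have h0 : 0 ≤ FracNonlocal.l2Norm Ω (U 0) := Real.sqrt_nonneg _
  have h1 : 0 ≤ FracNonlocal.gradNorm Ω (U 0) := Real.sqrt_nonneg _
  have hl2 := FracNonlocal.le_l2Const_mul hα0 ht htT hG h0 hbounds.1
  have hgrad := FracNonlocal.le_gradConst_mul hm₁ hα0 ht htT hG h1 hbounds.2
  refine ⟨hl2, hgrad, fun hα hGF => ?_⟩
  have hC := FracNonlocal.l2Const_le_robustConst (m₁ := m₁) hα₀ hα hα1 hT ht htT hG hGF
  have hC' := FracNonlocal.gradConst_le_robustConst (m₁ := m₁) hα₀ hα hα1 hT ht htT hG hGF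
  exact ⟨hC, hC', hl2.trans (mul_le_mul_of_nonneg_right hC (by linarith)),
    hgrad.trans (mul_le_mul_of_nonneg_right hC' (by linarith))⟩
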